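/- Let $\mathbb K=\mathbb R$ or $\mathbb K=\mathbb C$. For a real random variable $X$ put $\|X\|_{\psi_2}=\inf\{t>0:\mathbb E\exp(X^2/t^2)\le 2\}$, and let $K\ge 0$, $\kappa>0$. There exist constants $C_1,\dots,C_5>0$, depending only on $\mathbb K$, $K$ and $\kappa$, such that the following holds. Let $M$ be a probability distribution on $\mathbb R$ with mean zero, $\|M\|_{\psi_2}\le K$ and $\mathbb E M^4\ge(\mathbb E M^2)^2+\kappa$ (every zero-mean sub-Gaussian $M$ with $\mathbb E M^4>(\mathbb E M^2)^2$ is covered by suitable $K,\kappa$). Let $n,d$ be integers with $n\ge C_1d$, and let $\alpha_1,\dots,\alpha_n$ be independent, identically distributed random vectors in $\mathbb K^d$ such that, if $\mathbb K=\mathbb R$, the $d$ entries of $\alpha_k$ are i.i.d. with distribution $M$ and, if $\mathbb K=\mathbb C$, the $2d$ real and imaginary parts of the entries of $\alpha_k$ are i.i.d. with distribution $M$. Let $\eta=(\eta_1,\dots,\eta_n)^\top$ be an arbitrary (deterministic or random) real noise vector independent of $(\alpha_1,\dots,\alpha_n)$. For $x_0\in\mathbb K^d$ put $y_k=|\alpha_k^*x_0|^2+\eta_k$,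 and call $\widehat x\in\mathbb K^d$ an ERM estimator for $x_0$ if it minimizes $\sum_{k=1}^n\big(y_k-|\alpha_k^*x|^2\big)^2$ over $x\in\mathbb K^d$. Then: (a) with probability at least $1-\exp(-C_2n)$, for all $x_0\in\mathbb K^d$ and all ERM estimators $\widehat x$ for $x_0$ simultaneously, $$\|\widehat x\widehat x^*-x_0x_0^*\|_F\le\frac{C_3\|\eta\|}{\sqrt n};$$ (b) with probability at least $1-\exp(-C_4d)$, for all $x_0\in\mathbb K^d$ and all ERM estimators $\widehat x$ for $x_0$ simultaneously, $$\|\widehat x\widehat x^*-x_0x_0^*\|_F\le C_5\Big(\|\eta\|_\infty\sqrt{\frac dn}+\frac{|\mathbf 1^\top\eta|}{n}\Big).$$ Here $\|\eta\|$ is the Euclidean norm, $\|\eta\|_\infty=\max_k|\eta_k|$, $\mathbf 1=(1,\dots,1)^\top\in\mathbb R^n$, and $\|\cdot\|_F$ is the Frobenius norm. -/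

import Mathlib

open MeasureTheory ProbabilityTheory
open scoped ENNReal NNReal

attribute [local instance] Matrix.frobeniusNormedAddCommGroup

/-- The sub-Gaussian norm `‖X‖_ψ₂ = inf {t > 0 : 𝔼 exp (X² / t²) ≤ 2}` of a real random variable,
with value `∞` if no such `t` exists. -/
noncomputable def subGaussianNorm {Ω : Type*} [MeasurableSpace Ω] (X : Ω → ℝ) (P : Measure Ω) :
    ℝ≥0∞ :=
  ⨅ t ∈ {t : ℝ≥0 | 0 < t ∧ ∫⁻ ω, ENNReal.ofReal (Real.exp (X ω ^ 2 / (t : ℝ) ^ 2)) ∂P ≤ 2},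
    (t : ℝ≥0∞)

/-- The vector in `𝕜 ^ d` with entries `v_i + v_{i+d} * I`, where the `2d` real coordinates `v` are
indexed by `Fin d ⊕ Fin d`. For `𝕜 = ℝ` one has `RCLike.I = 0`, and the entries are simply `v_i`. -/
noncomputable def ofRealCoords (𝕜 : Type*) [RCLike 𝕜] (d : ℕ) (v : Fin d ⊕ Fin d → ℝ) :
    Fin d → 𝕜 :=
  fun i => (v (Sum.inl i) : 𝕜) + (v (Sum.inr i) : 𝕜) * RCLike.I

/-- The law of a measurement vector: for `𝕜 = ℂ` the `2d` real and imaginary parts of its entries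
are i.i.d. with distribution `M`; for `𝕜 = ℝ` its `d` entries are i.i.d. with distribution `M`. -/
noncomputable def measurementLaw (𝕜 : Type*) [RCLike 𝕜] (d : ℕ) (M : Measure ℝ) :
    Measure (Fin d → 𝕜) :=
  (Measure.pi (fun _ : Fin d ⊕ Fin d => M)).map (ofRealCoords 𝕜 d)

/-- The phaseless measurement `|a^* x|²`. -/
noncomputable def intensity {𝕜 : Type*} [RCLike 𝕜] {d : ℕ} (a x : Fin d → 𝕜) : ℝ :=
  ‖star a ⬝ᵥ x‖ ^ 2

/-- The empirical `ℓ₂` risk `∑ₖ (yₖ - |aₖ^* x|²)²`. -/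
noncomputable def empiricalRisk {𝕜 : Type*} [RCLike 𝕜] {n d : ℕ} (a : Fin n → Fin d → 𝕜)
    (y : Fin n → ℝ) (x : Fin d → 𝕜) : ℝ :=
  ∑ k, (y k - intensity (a k) x) ^ 2

/-- `xhat` is an ERM estimator: a global minimizer over `𝕜 ^ d` of the empirical risk for the noisy
responses `yₖ = |aₖ^* x₀|² + eₖ`. -/
def IsERM {𝕜 : Type*} [RCLike 𝕜] {n d : ℕ} (a : Fin n → Fin d → 𝕜) (e : Fin n → ℝ)
    (x₀ xhat : Fin d → 𝕜) : Prop :=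
  IsMinOn (empiricalRisk a (fun k => intensity (a k) x₀ + e k)) Set.univ xhat

/-- The reconstruction error `‖x x^* - x₀ x₀^*‖_F` (Frobenius norm). -/
noncomputable def liftedDist {𝕜 : Type*} [RCLike 𝕜] {d : ℕ} (x x₀ : Fin d → 𝕜) : ℝ :=
  ‖Matrix.vecMulVec x (star x) - Matrix.vecMulVec x₀ (star x₀)‖

/-!
A minimizer of the empirical risk may be multiplied by a phase without changing the risk or the
reconstruction error, so its inner product with the signal may be taken real. Put `p = x - z` and
`q = x + z` for the minimizer `x` and the signal `z`. Then `x x^* - z z^* = (p q^* + q p^*) / 2` has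
Frobenius norm at most `‖p‖ ‖q‖`, the differences of intensities are the values
`f_k = Re (conj (a_k^* p) (a_k^* q))` of the real forms `crossForm`, and minimality gives
`∑ f_k² ≤ 2 ∑ η_k f_k` (`IsERM.exists_pair`).

The left-hand side is bounded below by a restricted lower isometry: with probability exponentially
close to one in `n`, the average of `|f_k|` is at least a constant times `‖p‖ ‖q‖` for all pairs with
real inner product (`exists_event_hasLowerBound`). For a fixed pair this is a lower-tail bound for
nonnegative variables. It needs `𝔼 |f_k|` to be bounded below, which follows from an exact computation
of the second moment of a quadratic form in independent variables, where `𝔼 M⁴ > (𝔼 M²)²` enters,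
and from the boundedness of all moments. Working with `|f_k|` rather than `f_k²` makes the extension
from a net to all pairs follow from a bound for the sample covariance.

For the Euclidean bound, the right-hand side is estimated by the Cauchy-Schwarz inequality. For the
refined bound it is the polarization of the quadratic form `∑ η_k |a_k^* u|²`, which concentrates
around `s ∑ η_k` on the unit sphere, `s` being the second moment of an amplitude
(`exists_event_abs_weighted_sum_le`): a Chernoff bound at a fixed unit vector and a fixed value of
the noise, a union bound over a `1/4`-net, and integration over the independent noise.

All tail bounds rest on `∫ exp (c |a^* u|²) ≤ 2` for unit vectors `u`, derived from the moment
generating function of the entries by Gaussian linearization (`lintegral_exp_mul_sq_le`).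
-/

namespace PhaseRetrieval

/-! ### Nets and quadratic forms -/

/-- Volume comparison: the balls of radius `ε / 2` around the points are disjoint and contained in the
ball of radius `1 + ε / 2`. -/
theorem card_le_of_separated_of_norm_le_one {E : Type*} [NormedAddCommGroup E] [NormedSpace ℝ E]
    [FiniteDimensional ℝ E] {ε : ℝ} (hε : 0 < ε) (s : Finset E) (hs : ∀ x ∈ s, ‖x‖ ≤ 1)
    (h : ∀ x ∈ s, ∀ y ∈ s, x ≠ y → ε ≤ ‖x - y‖) :
    (s.card : ℝ) ≤ (1 + 2 / ε) ^ Module.finrank ℝ E := by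
  borelize E
  let μ : Measure E := Measure.addHaar
  have hδ : 0 < ε / 2 := by positivity
  have hρ : 0 < 1 + ε / 2 := by positivity
  have D : Set.Pairwise (s : Set E)
      (Function.onFun Disjoint fun c => Metric.ball (c : E) (ε / 2)) := by
    rintro c hc d hd hcd
    apply Metric.ball_disjoint_ball
    rw [dist_eq_norm]
    have := h c hc d hd hcd
    linarith
  have hsub : (⋃ c ∈ s, Metric.ball (c : E) (ε / 2)) ⊆ Metric.ball (0 : E) (1 + ε / 2) := by
    refine Set.iUnion₂_subset fun x hx => Metric.ball_subset_ball' ?_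
    rw [dist_zero_right]
    have := hs x hx
    linarith
  have I : (s.card : ℝ≥0∞) * ENNReal.ofReal ((ε / 2) ^ Module.finrank ℝ E) * μ (Metric.ball 0 1) ≤
      ENNReal.ofReal ((1 + ε / 2) ^ Module.finrank ℝ E) * μ (Metric.ball 0 1) :=
    calc
      _ = μ (⋃ c ∈ s, Metric.ball (c : E) (ε / 2)) := by
        rw [measure_biUnion_finset D fun c _ => measurableSet_ball]
        simp only [μ.addHaar_ball_of_pos _ hδ, Finset.sum_const, nsmul_eq_mul, mul_assoc]
      _ ≤ μ (Metric.ball (0 : E) (1 + ε / 2)) := measure_mono hsub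
      _ = _ := by simp only [μ.addHaar_ball_of_pos _ hρ]
  have J := (ENNReal.mul_le_mul_iff_left (Metric.measure_ball_pos _ _ zero_lt_one).ne'
    measure_ball_lt_top.ne).1 I
  have K := ENNReal.toReal_le_of_le_ofReal (pow_nonneg hρ.le _) J
  rw [ENNReal.toReal_mul, ENNReal.toReal_natCast, ENNReal.toReal_ofReal (by positivity)] at K
  have hq : (1 : ℝ) + 2 / ε = (1 + ε / 2) / (ε / 2) := by field_simp; ring
  rw [hq, div_pow, le_div_iff₀ (by positivity)]
  exact K

/-- A subset of the unit ball has an internal `ε`-net of cardinality at most `(1 + 2 / ε) ^ dim`: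
a maximal separated subset. -/
theorem exists_finset_net {E : Type*} [NormedAddCommGroup E] [NormedSpace ℝ E]
    [FiniteDimensional ℝ E] (S : Set E) (hS : ∀ x ∈ S, ‖x‖ ≤ 1) {ε : ℝ} (hε : 0 < ε) :
    ∃ N : Finset E, (∀ y ∈ N, y ∈ S) ∧ (N.card : ℝ) ≤ (1 + 2 / ε) ^ Module.finrank ℝ E ∧
      ∀ x ∈ S, ∃ y ∈ N, ‖x - y‖ ≤ ε := by
  classical
  let A : Set ℕ := {k | ∃ s : Finset E, (∀ y ∈ s, y ∈ S) ∧
    (∀ x ∈ s, ∀ y ∈ s, x ≠ y → ε ≤ ‖x - y‖) ∧ s.card = k}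
  have hA : BddAbove A := by
    refine ⟨⌊(1 + 2 / ε) ^ Module.finrank ℝ E⌋₊, ?_⟩
    rintro k ⟨s, h1, h2, rfl⟩
    exact Nat.le_floor (card_le_of_separated_of_norm_le_one hε s (fun x hx => hS x (h1 x hx)) h2)
  have hne : A.Nonempty := ⟨0, ∅, by simp, by simp, by simp⟩
  obtain ⟨s, h1, h2, h3⟩ := Nat.sSup_mem hne hA
  refine ⟨s, h1, card_le_of_separated_of_norm_le_one hε s (fun x hx => hS x (h1 x hx)) h2, ?_⟩
  intro x hx
  by_contra! hcon
  have hxs : x ∉ s := fun hmem => by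
    have := hcon x hmem
    simp only [sub_self, norm_zero] at this
    linarith
  have hmem : (insert x s).card ∈ A := by
    refine ⟨insert x s, ?_, ?_, rfl⟩
    · intro y hy
      rcases Finset.mem_insert.1 hy with rfl | hy
      exacts [hx, h1 y hy]
    · intro y hy z hz hyz
      rcases Finset.mem_insert.1 hy with hy' | hy' <;> rcases Finset.mem_insert.1 hz with hz' | hz'
      · exact absurd (hy'.trans hz'.symm) hyz
      · rw [hy']; exact (hcon z hz').le
      · rw [hz', norm_sub_rev]; exact (hcon y hy').le
      · exact h2 y hy' z hz' hyz
  have := le_csSup hA hmem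
  rw [Finset.card_insert_of_notMem hxs, h3] at this
  omega

section PolarizedForms

variable {𝕜 : Type*} [RCLike 𝕜] {ι : Type*} [Fintype ι]

/-- Polarization: a symmetric form is controlled by its values on the diagonal. -/
theorem abs_bilin_le_of_abs_diag_le {Q : LinearMap.BilinForm ℝ (EuclideanSpace 𝕜 ι)}
    (hsymm : ∀ u v, Q u v = Q v u) {B : ℝ} (hQ : ∀ u, |Q u u| ≤ B * ‖u‖ ^ 2)
    (u v : EuclideanSpace 𝕜 ι) : |Q u v| ≤ B * (‖u‖ * ‖v‖) := by
  have unit_case : ∀ u v : EuclideanSpace 𝕜 ι, ‖u‖ = 1 → ‖v‖ = 1 → |Q u v| ≤ B := by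
    intro u v hu hv
    have h1 := hQ (u + v)
    have h2 := hQ (u - v)
    have hp := parallelogram_law_with_norm 𝕜 u v
    rw [hu, hv] at hp
    have e : 4 * Q u v = Q (u + v) (u + v) - Q (u - v) (u - v) := by
      simp only [map_add, map_sub, LinearMap.add_apply, LinearMap.sub_apply]
      rw [hsymm v u]; ring
    rw [abs_le] at h1 h2 ⊢
    constructor <;> nlinarith
  rcases eq_or_ne u 0 with rfl | hu
  · simp
  rcases eq_or_ne v 0 with rfl | hv
  · simp
  have hu' : 0 < ‖u‖ := norm_pos_iff.2 hu
  have hv' : 0 < ‖v‖ := norm_pos_iff.2 hv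
  have h := unit_case (‖u‖⁻¹ • u) (‖v‖⁻¹ • v) (by rw [norm_smul]; simp [hu'.ne'])
    (by rw [norm_smul]; simp [hv'.ne'])
  simp only [map_smul, LinearMap.smul_apply, smul_eq_mul, abs_mul, abs_inv, abs_norm] at h
  have e : |Q u v| = (‖v‖⁻¹ * (‖u‖⁻¹ * |Q u v|)) * (‖u‖ * ‖v‖) := by field_simp
  rw [e]
  gcongr

/-- A symmetric form bounded by `m` on a `1/4`-net of the unit sphere is bounded by `2 * m` on the
whole sphere. -/
theorem abs_bilin_le_of_net {Q : LinearMap.BilinForm ℝ (EuclideanSpace 𝕜 ι)}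
    (hsymm : ∀ u v, Q u v = Q v u) {B : ℝ} (hQ : ∀ u, |Q u u| ≤ B * ‖u‖ ^ 2)
    {N : Finset (EuclideanSpace 𝕜 ι)} (hN1 : ∀ y ∈ N, ‖y‖ = 1)
    (hN : ∀ x : EuclideanSpace 𝕜 ι, ‖x‖ = 1 → ∃ y ∈ N, ‖x - y‖ ≤ 1 / 4)
    {m : ℝ} (hm : ∀ y ∈ N, |Q y y| ≤ m) (u v : EuclideanSpace 𝕜 ι) :
    |Q u v| ≤ 2 * m * (‖u‖ * ‖v‖) := by
  -- One approximation step turns an a priori bound `B` into `m + B / 2`.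
  have step : ∀ B : ℝ, (∀ u, |Q u u| ≤ B * ‖u‖ ^ 2) → ∀ u, |Q u u| ≤ (m + B / 2) * ‖u‖ ^ 2 := by
    intro B hB u
    rcases eq_or_ne u 0 with rfl | hu
    · simp
    have hu' : 0 < ‖u‖ := norm_pos_iff.2 hu
    set w := ‖u‖⁻¹ • u with hw
    have hw1 : ‖w‖ = 1 := by rw [hw, norm_smul]; simp [hu'.ne']
    have hB0 : 0 ≤ B := by
      have := (abs_nonneg _).trans (hB w)
      rw [hw1] at this; linarith
    obtain ⟨y, hy, hwy⟩ := hN w hw1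
    have e : Q w w = Q y y + Q (w - y) (w + y) := by
      simp only [map_add, map_sub, LinearMap.sub_apply]
      rw [hsymm y w]; ring
    have h1 := abs_bilin_le_of_abs_diag_le hsymm hB (w - y) (w + y)
    have h2 : ‖w + y‖ ≤ 2 := (norm_add_le _ _).trans (by rw [hw1, hN1 y hy]; norm_num)
    have h3 : |Q w w| ≤ m + B / 2 := by
      rw [e]
      refine (abs_add_le _ _).trans (add_le_add (hm y hy) (h1.trans ?_))
      calc B * (‖w - y‖ * ‖w + y‖) ≤ B * (1 / 4 * 2) := by gcongr
        _ = B / 2 := by ring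
    have e2 : Q u u = ‖u‖ ^ 2 * Q w w := by
      simp only [hw, map_smul, LinearMap.smul_apply, smul_eq_mul]
      field_simp
    rw [e2, abs_mul, abs_of_nonneg (by positivity), mul_comm]
    gcongr
  have iter : ∀ k : ℕ, ∀ u, |Q u u| ≤ (2 * m + (B - 2 * m) * (1 / 2) ^ k) * ‖u‖ ^ 2 := by
    intro k
    induction k with
    | zero => simpa using hQ
    | succ k ih =>
      intro u
      refine (step _ ih u).trans (le_of_eq ?_)
      rw [pow_succ]; ring
  refine abs_bilin_le_of_abs_diag_le hsymm (fun u => ?_) u v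
  have hlim : Filter.Tendsto (fun k : ℕ => (2 * m + (B - 2 * m) * (1 / 2 : ℝ) ^ k) * ‖u‖ ^ 2)
      Filter.atTop (nhds ((2 * m + (B - 2 * m) * 0) * ‖u‖ ^ 2)) :=
    ((tendsto_const_nhds.add (tendsto_const_nhds.mul
      (tendsto_pow_atTop_nhds_zero_of_lt_one (by norm_num) (by norm_num)))).mul
      tendsto_const_nhds)
  have := ge_of_tendsto' hlim (fun k => iter k u)
  simpa using this

end PolarizedForms

/-! ### Elementary inequalities for the exponential -/

theorem exp_le_add_exp_sq (x : ℝ) : Real.exp x ≤ x + Real.exp (x ^ 2) := by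
  have hsq := Real.add_one_le_exp (x ^ 2)
  rcases le_total |x| 1 with h | h
  · have := (abs_le.1 (Real.abs_exp_sub_one_sub_id_le h)).2
    linarith
  rcases le_total 0 x with h0 | h0
  · rw [abs_of_nonneg h0] at h
    have : Real.exp x ≤ Real.exp (x ^ 2) := Real.exp_le_exp.2 (by nlinarith)
    linarith
  · rw [abs_of_nonpos h0] at h
    have : Real.exp x ≤ 1 := Real.exp_le_one_iff.2 h0
    nlinarith

theorem exp_neg_le_one_sub_add_sq {y : ℝ} (hy : 0 ≤ y) : Real.exp (-y) ≤ 1 - y + y ^ 2 := by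
  rcases le_total y 1 with h | h
  · have := (abs_le.1 (Real.abs_exp_sub_one_sub_id_le (x := -y)
      (by rw [abs_neg, abs_of_nonneg hy]; exact h))).2
    nlinarith
  · have : Real.exp (-y) ≤ 1 := Real.exp_le_one_iff.2 (by linarith)
    nlinarith

theorem exp_le_one_add_add_sq_mul_exp_abs (x : ℝ) :
    Real.exp x ≤ 1 + x + x ^ 2 * Real.exp |x| := by
  have h1 : 1 ≤ Real.exp |x| := Real.one_le_exp (abs_nonneg x)
  have h2 : x ^ 2 ≤ x ^ 2 * Real.exp |x| := le_mul_of_one_le_right (sq_nonneg x) h1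
  rcases le_total |x| 1 with h | h
  · have := (abs_le.1 (Real.abs_exp_sub_one_sub_id_le h)).2
    linarith
  rcases le_total 0 x with h0 | h0
  · rw [abs_of_nonneg h0] at h ⊢
    have : Real.exp x ≤ x ^ 2 * Real.exp x :=
      le_mul_of_one_le_left (Real.exp_pos x).le (by nlinarith)
    linarith
  · rw [abs_of_nonpos h0] at h
    have : Real.exp x ≤ 1 := Real.exp_le_one_iff.2 h0
    nlinarith

theorem pow_le_factorial_mul_exp {x : ℝ} (hx : 0 ≤ x) (k : ℕ) :
    x ^ k ≤ k.factorial * Real.exp x := by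
  have := Real.pow_div_factorial_le_exp x hx k
  rwa [div_le_iff₀ (by positivity), mul_comm] at this

/-! ### Sub-Gaussian laws on the line -/

/-- The infimum in the sub-Gaussian norm need not be attained at a positive value (the norm may
vanish), so the scale `K` is enlarged to `K + 1`. -/
theorem integrable_exp_sq_of_subGaussianNorm_le {M : Measure ℝ} {K : ℝ≥0}
    (h : subGaussianNorm (fun t : ℝ => t) M ≤ K) :
    Integrable (fun x : ℝ => Real.exp (x ^ 2 / ((K : ℝ) + 1) ^ 2)) M ∧
      ∫ x, Real.exp (x ^ 2 / ((K : ℝ) + 1) ^ 2) ∂M ≤ 2 := by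
  have hlt : subGaussianNorm (fun t : ℝ => t) M < ((K + 1 : ℝ≥0) : ℝ≥0∞) :=
    h.trans_lt (by exact_mod_cast lt_add_one K)
  simp only [subGaussianNorm, iInf_lt_iff] at hlt
  obtain ⟨t, ⟨ht0, ht⟩, htK⟩ := hlt
  have htK' : (t : ℝ) ≤ (K : ℝ) + 1 := by exact_mod_cast (ENNReal.coe_lt_coe.1 htK).le
  have ht0' : (0 : ℝ) < t := by exact_mod_cast ht0
  have hl : ∫⁻ x, ENNReal.ofReal (Real.exp (x ^ 2 / ((K : ℝ) + 1) ^ 2)) ∂M ≤ 2 :=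
    (lintegral_mono fun x => ENNReal.ofReal_le_ofReal (Real.exp_le_exp.2 (by gcongr))).trans ht
  have hint : Integrable (fun x : ℝ => Real.exp (x ^ 2 / ((K : ℝ) + 1) ^ 2)) M := by
    refine ⟨by fun_prop, ?_⟩
    rw [hasFiniteIntegral_iff_ofReal (ae_of_all _ fun x => (Real.exp_pos _).le)]
    exact hl.trans_lt (by norm_num)
  refine ⟨hint, ?_⟩
  rw [integral_eq_lintegral_of_nonneg_ae (ae_of_all _ fun x => (Real.exp_pos _).le) (by fun_prop)]
  exact ENNReal.toReal_le_of_le_ofReal (by norm_num) (by simpa using hl)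

section Line

variable {M : Measure ℝ} {t : ℝ}

theorem integrable_pow_of_integrable_exp_sq [IsProbabilityMeasure M] (ht : 0 < t)
    (hint : Integrable (fun x : ℝ => Real.exp (x ^ 2 / t ^ 2)) M) (k : ℕ) :
    Integrable (fun x : ℝ => x ^ k) M := by
  refine Integrable.mono' ((integrable_const (1 : ℝ)).add
    (hint.const_mul (t ^ (2 * k) * k.factorial))) (by fun_prop) (ae_of_all _ fun x => ?_)
  simp only [Pi.add_apply, norm_pow, Real.norm_eq_abs]
  have h1 : |x| ^ k ≤ 1 + (x ^ 2) ^ k := by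
    have : (x ^ 2) ^ k = (|x| ^ k) ^ 2 := by rw [← sq_abs]; ring
    rw [this]
    nlinarith [sq_nonneg (|x| ^ k - 1), pow_nonneg (abs_nonneg x) k]
  have h2 := pow_le_factorial_mul_exp (x := x ^ 2 / t ^ 2) (by positivity) k
  have h3 : (x ^ 2) ^ k = t ^ (2 * k) * (x ^ 2 / t ^ 2) ^ k := by
    rw [div_pow, ← pow_mul, ← pow_mul]; field_simp
  rw [h3] at h1
  calc |x| ^ k ≤ 1 + t ^ (2 * k) * (x ^ 2 / t ^ 2) ^ k := h1
    _ ≤ 1 + t ^ (2 * k) * (k.factorial * Real.exp (x ^ 2 / t ^ 2)) := by gcongr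
    _ = _ := by ring

theorem integrable_exp_mul_of_integrable_exp_sq (ht : 0 < t)
    (hint : Integrable (fun x : ℝ => Real.exp (x ^ 2 / t ^ 2)) M) (l : ℝ) :
    Integrable (fun x : ℝ => Real.exp (l * x)) M := by
  refine Integrable.mono' (hint.const_mul (Real.exp (l ^ 2 * t ^ 2))) (by fun_prop)
    (ae_of_all _ fun x => ?_)
  rw [Real.norm_eq_abs, Real.abs_exp, ← Real.exp_add]
  refine Real.exp_le_exp.2 ?_
  have e : x ^ 2 / t ^ 2 = (x / t) ^ 2 := by rw [div_pow]
  have e2 : l * x = (l * t) * (x / t) := by field_simp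
  rw [e, e2]
  nlinarith [sq_nonneg (l * t - x / t), sq_nonneg (l * t), sq_nonneg (x / t)]

/-- A centred law with `𝔼 exp (X² / t²) ≤ 2` has moment generating function at most
`exp (t² l²)`. For `|l| t ≤ 1` this uses `exp x ≤ x + exp x²` and the convexity of `exp`; for larger
`l` the product `l x` is split by the arithmetic-geometric mean inequality. -/
theorem integral_exp_mul_le [IsProbabilityMeasure M] (ht : 0 < t)
    (hint : Integrable (fun x : ℝ => Real.exp (x ^ 2 / t ^ 2)) M)
    (h2 : ∫ x, Real.exp (x ^ 2 / t ^ 2) ∂M ≤ 2) (hmean : ∫ x, x ∂M = 0) (l : ℝ) :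
    ∫ x, Real.exp (l * x) ∂M ≤ Real.exp (t ^ 2 * l ^ 2) := by
  have hid : Integrable (fun x : ℝ => x) M := by
    simpa using integrable_pow_of_integrable_exp_sq ht hint 1
  have hexp := integrable_exp_mul_of_integrable_exp_sq ht hint l
  set θ := t ^ 2 * l ^ 2 with hθ
  have hθ0 : 0 ≤ θ := by positivity
  have conv : ∀ s : ℝ, 0 ≤ s → s ≤ 1 → ∀ y : ℝ, Real.exp (s * y) ≤ 1 - s + s * Real.exp y := by
    intro s hs0 hs1 y
    have := convexOn_exp.2 (Set.mem_univ 0) (Set.mem_univ y) (sub_nonneg.2 hs1) hs0 (by ring)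
    simpa using this
  rcases le_total θ 1 with h | h
  · have hb : ∀ x : ℝ, Real.exp (l * x) ≤ l * x + (1 - θ + θ * Real.exp (x ^ 2 / t ^ 2)) := by
      intro x
      refine (exp_le_add_exp_sq _).trans ?_
      have := conv θ hθ0 h (x ^ 2 / t ^ 2)
      have e : θ * (x ^ 2 / t ^ 2) = (l * x) ^ 2 := by rw [hθ]; field_simp
      rw [e] at this
      linarith
    have hi2 : Integrable (fun x : ℝ => 1 - θ + θ * Real.exp (x ^ 2 / t ^ 2)) M :=
      (integrable_const _).add (hint.const_mul θ)
    calc ∫ x, Real.exp (l * x) ∂M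
        ≤ ∫ x, (l * x + (1 - θ + θ * Real.exp (x ^ 2 / t ^ 2))) ∂M :=
          integral_mono hexp ((hid.const_mul l).add hi2) hb
      _ = 1 - θ + θ * ∫ x, Real.exp (x ^ 2 / t ^ 2) ∂M := by
          rw [integral_add (hid.const_mul l) hi2, integral_const_mul, hmean,
            integral_add (integrable_const _) (hint.const_mul θ), integral_const_mul]
          simp
      _ ≤ θ + 1 := by nlinarith
      _ ≤ Real.exp θ := Real.add_one_le_exp θ
  · have hb : ∀ x : ℝ, Real.exp (l * x) ≤
        Real.exp (θ / 2) * (1 - 1 / 2 + 1 / 2 * Real.exp (x ^ 2 / t ^ 2)) := by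
      intro x
      refine le_trans ?_ (mul_le_mul_of_nonneg_left
        (conv (1 / 2) (by norm_num) (by norm_num) (x ^ 2 / t ^ 2)) (Real.exp_pos _).le)
      rw [← Real.exp_add]
      refine Real.exp_le_exp.2 ?_
      have e : x ^ 2 / t ^ 2 = (x / t) ^ 2 := by rw [div_pow]
      have e2 : l * x = (t * l) * (x / t) := by field_simp
      have e3 : θ = (t * l) ^ 2 := by rw [hθ]; ring
      rw [e, e2, e3]
      nlinarith [sq_nonneg (t * l - x / t)]
    have hi2 : Integrable (fun x : ℝ => 1 - 1 / 2 + 1 / 2 * Real.exp (x ^ 2 / t ^ 2)) M :=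
      (integrable_const _).add (hint.const_mul _)
    calc ∫ x, Real.exp (l * x) ∂M
        ≤ ∫ x, Real.exp (θ / 2) * (1 - 1 / 2 + 1 / 2 * Real.exp (x ^ 2 / t ^ 2)) ∂M :=
          integral_mono hexp (hi2.const_mul _) hb
      _ = Real.exp (θ / 2) * (1 / 2 + 1 / 2 * ∫ x, Real.exp (x ^ 2 / t ^ 2) ∂M) := by
          rw [integral_const_mul, integral_add (integrable_const _) (hint.const_mul _),
            integral_const_mul]
          norm_num
      _ ≤ Real.exp (θ / 2) * Real.exp (θ / 2) := by
          gcongr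
          have := Real.add_one_le_exp (θ / 2)
          linarith
      _ = Real.exp θ := by rw [← Real.exp_add]; ring_nf

/-- A lower bound for the second moment in terms of the fourth: mass at large values is controlled by
the sixth moment. -/
theorem sq_div_le_integral_sq [IsProbabilityMeasure M] (ht : 0 < t)
    (hint : Integrable (fun x : ℝ => Real.exp (x ^ 2 / t ^ 2)) M)
    (h2 : ∫ x, Real.exp (x ^ 2 / t ^ 2) ∂M ≤ 2) {κ : ℝ} (hκ : 0 < κ)
    (h4 : κ ≤ ∫ x, x ^ 4 ∂M) : κ ^ 2 / (48 * t ^ 6) ≤ ∫ x, x ^ 2 ∂M := by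
  have hi := integrable_pow_of_integrable_exp_sq ht hint
  -- The weight in `x⁴ ≤ T x² + T⁻¹ x⁶` that makes the contribution of the sixth moment at most `κ / 2`.
  set T := 24 * t ^ 6 / κ with hT
  have hT0 : 0 < T := by positivity
  have h6 : ∫ x, x ^ 6 ∂M ≤ 12 * t ^ 6 := by
    calc ∫ x, x ^ 6 ∂M ≤ ∫ x, t ^ 6 * 6 * Real.exp (x ^ 2 / t ^ 2) ∂M := by
          refine integral_mono (hi 6) (hint.const_mul _) fun x => ?_
          have := pow_le_factorial_mul_exp (x := x ^ 2 / t ^ 2) (by positivity) 3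
          have e : x ^ 6 = t ^ 6 * (x ^ 2 / t ^ 2) ^ 3 := by
            field_simp
          simp only [e, mul_assoc]
          gcongr
          simpa [Nat.factorial] using this
      _ ≤ 12 * t ^ 6 := by
          rw [integral_const_mul]
          nlinarith [pow_pos ht 6]
  have hp : ∀ x : ℝ, x ^ 4 ≤ T * x ^ 2 + T⁻¹ * x ^ 6 := by
    intro x
    have : T * x ^ 2 + T⁻¹ * x ^ 6 - 2 * x ^ 4 = T⁻¹ * (x * (T - x ^ 2)) ^ 2 := by
      field_simp; ring
    have h0 : 0 ≤ T⁻¹ * (x * (T - x ^ 2)) ^ 2 := by positivity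
    have h1 : 0 ≤ x ^ 4 := by positivity
    linarith
  have hm : ∫ x, x ^ 4 ∂M ≤ T * ∫ x, x ^ 2 ∂M + T⁻¹ * ∫ x, x ^ 6 ∂M := by
    rw [← integral_const_mul, ← integral_const_mul,
      ← integral_add ((hi 2).const_mul _) ((hi 6).const_mul _)]
    exact integral_mono (hi 4) (((hi 2).const_mul _).add ((hi 6).const_mul _)) hp
  have h7 : T⁻¹ * ∫ x, x ^ 6 ∂M ≤ κ / 2 := by
    calc T⁻¹ * ∫ x, x ^ 6 ∂M ≤ T⁻¹ * (12 * t ^ 6) := by gcongr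
      _ = κ / 2 := by rw [hT]; field_simp; ring
  have h8 : κ / 2 ≤ T * ∫ x, x ^ 2 ∂M := by linarith
  have h9 : κ ^ 2 / (48 * t ^ 6) = T⁻¹ * (κ / 2) := by rw [hT]; field_simp; ring
  rw [h9, inv_mul_le_iff₀ hT0]
  exact h8

end Line

theorem lintegral_exp_sq_div_four_gaussianReal_le :
    ∫⁻ g, ENNReal.ofReal (Real.exp (g ^ 2 / 4)) ∂(gaussianReal 0 1) ≤ ENNReal.ofReal 2 := by
  have e : ∀ g : ℝ, gaussianPDFReal 0 1 g * Real.exp (g ^ 2 / 4) =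
      (√(2 * Real.pi))⁻¹ * Real.exp (-(1 / 4) * g ^ 2) := by
    intro g
    simp only [gaussianPDFReal, NNReal.coe_one, mul_one, sub_zero]
    rw [mul_assoc, ← Real.exp_add]
    congr 2; ring
  rw [gaussianReal_of_var_ne_zero _ one_ne_zero,
    lintegral_withDensity_eq_lintegral_mul _ (measurable_gaussianPDF _ _) (by fun_prop)]
  have e2 : ∀ g : ℝ, (gaussianPDF 0 1 * fun g => ENNReal.ofReal (Real.exp (g ^ 2 / 4))) g =
      ENNReal.ofReal ((√(2 * Real.pi))⁻¹ * Real.exp (-(1 / 4) * g ^ 2)) := by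
    intro g
    rw [← e, ENNReal.ofReal_mul (gaussianPDFReal_nonneg _ _ _)]
    rfl
  rw [lintegral_congr e2, ← ofReal_integral_eq_lintegral_ofReal
    ((integrable_exp_neg_mul_sq (by norm_num)).const_mul _)
    (ae_of_all _ fun g => by positivity), integral_const_mul, integral_gaussian]
  refine ENNReal.ofReal_le_ofReal ?_
  rw [inv_mul_le_iff₀ (by positivity)]
  refine (Real.sqrt_le_iff).2 ⟨by positivity, ?_⟩
  rw [mul_pow, Real.sq_sqrt (by positivity)]
  nlinarith [Real.pi_pos]

/-- The exponential of a squared sub-Gaussian variable is integrable: write `exp (c X²)` as the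
expectation of `exp (√(2 c) g X)` over an independent standard Gaussian `g` and exchange the two
expectations. -/
theorem lintegral_exp_mul_sq_le {Ω : Type*} [MeasurableSpace Ω] {P : Measure Ω}
    [IsProbabilityMeasure P] {X : Ω → ℝ} (hX : Measurable X) {b c : ℝ} (hc : 0 ≤ c)
    (hbc : 8 * b * c ≤ 1) (hint : ∀ l : ℝ, Integrable (fun ω => Real.exp (l * X ω)) P)
    (hle : ∀ l : ℝ, ∫ ω, Real.exp (l * X ω) ∂P ≤ Real.exp (b * l ^ 2)) :
    ∫⁻ ω, ENNReal.ofReal (Real.exp (c * X ω ^ 2)) ∂P ≤ ENNReal.ofReal 2 := by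
  have h1 : ∀ ω, ENNReal.ofReal (Real.exp (c * X ω ^ 2)) =
      ∫⁻ g, ENNReal.ofReal (Real.exp ((√(2 * c) * g) * X ω)) ∂(gaussianReal 0 1) := by
    intro ω
    have hm := congrFun (mgf_fun_id_gaussianReal (μ := 0) (v := 1)) (√(2 * c) * X ω)
    rw [mgf] at hm
    have hi := integrable_exp_mul_gaussianReal (μ := 0) (v := 1) (√(2 * c) * X ω)
    have e : ∀ g : ℝ, (√(2 * c) * g) * X ω = √(2 * c) * X ω * g := fun g => by ring
    simp only [e]
    rw [← ofReal_integral_eq_lintegral_ofReal hi (ae_of_all _ fun g => (Real.exp_pos _).le), hm]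
    congr 2
    rw [mul_pow, Real.sq_sqrt (by positivity)]
    simp
    ring
  rw [lintegral_congr h1, lintegral_lintegral_swap (by fun_prop)]
  refine le_trans (lintegral_mono fun g => ?_) lintegral_exp_sq_div_four_gaussianReal_le
  rw [← ofReal_integral_eq_lintegral_ofReal (hint _) (ae_of_all _ fun ω => (Real.exp_pos _).le)]
  refine ENNReal.ofReal_le_ofReal ((hle _).trans (Real.exp_le_exp.2 ?_))
  rw [mul_pow, Real.sq_sqrt (by positivity)]
  nlinarith [sq_nonneg g]

/-! ### Linear and quadratic forms in independent variables -/

section Product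

variable {ι : Type*} [Fintype ι] {M : Measure ℝ} [IsProbabilityMeasure M]

theorem integrable_exp_linear (hexp : ∀ l : ℝ, Integrable (fun x : ℝ => Real.exp (l * x)) M)
    (w : ι → ℝ) (l : ℝ) :
    Integrable (fun v : ι → ℝ => Real.exp (l * ∑ j, w j * v j)) (Measure.pi fun _ => M) := by
  have h := Integrable.fintype_prod (μ := fun _ : ι => M)
    (f := fun j (x : ℝ) => Real.exp ((l * w j) * x)) (fun j => hexp _)
  refine h.congr (ae_of_all _ fun v => ?_)
  simp only [← Real.exp_sum, Finset.mul_sum, mul_assoc]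

theorem integral_exp_linear_le {b : ℝ}
    (hle : ∀ l : ℝ, ∫ x, Real.exp (l * x) ∂M ≤ Real.exp (b * l ^ 2)) (w : ι → ℝ) (l : ℝ) :
    ∫ v : ι → ℝ, Real.exp (l * ∑ j, w j * v j) ∂(Measure.pi fun _ => M) ≤
      Real.exp (b * (∑ j, w j ^ 2) * l ^ 2) := by
  have h := integral_fintype_prod_eq_prod (𝕜 := ℝ) (μ := fun _ : ι => M)
    (fun j (x : ℝ) => Real.exp ((l * w j) * x))
  have e : (fun v : ι → ℝ => Real.exp (l * ∑ j, w j * v j)) =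
      fun v => ∏ j, Real.exp ((l * w j) * v j) := by
    funext v
    simp only [← Real.exp_sum, Finset.mul_sum, mul_assoc]
  rw [e, h]
  calc ∏ j, ∫ x, Real.exp ((l * w j) * x) ∂M ≤ ∏ j, Real.exp (b * (l * w j) ^ 2) :=
        Finset.prod_le_prod (fun j _ => integral_nonneg fun x => (Real.exp_pos _).le)
          fun j _ => hle _
    _ = _ := by
        rw [← Real.exp_sum, Finset.mul_sum, Finset.sum_mul]
        congr 1
        exact Finset.sum_congr rfl fun j _ => by ring

theorem integrable_prod_pow (hmom : ∀ k : ℕ, Integrable (fun x : ℝ => x ^ k) M) (m : ι → ℕ) :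
    Integrable (fun v : ι → ℝ => ∏ a, v a ^ m a) (Measure.pi fun _ => M) :=
  Integrable.fintype_prod (μ := fun _ : ι => M) (f := fun a (x : ℝ) => x ^ m a)
    fun _ => hmom _

theorem integral_prod_pow (m : ι → ℕ) :
    ∫ v : ι → ℝ, ∏ a, v a ^ m a ∂(Measure.pi fun _ => M) = ∏ a, ∫ x, x ^ m a ∂M :=
  integral_fintype_prod_eq_prod (𝕜 := ℝ) (μ := fun _ : ι => M) (fun a (x : ℝ) => x ^ m a)

variable [DecidableEq ι]

theorem mul_four_eq_prod_pow (v : ι → ℝ) (i j k l : ι) : v i * v j * v k * v l =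
    ∏ a, v a ^ ((if a = i then 1 else 0) + (if a = j then 1 else 0) + (if a = k then 1 else 0) +
      (if a = l then 1 else 0)) := by
  simp only [pow_add, Finset.prod_mul_distrib, pow_ite, pow_one, pow_zero, Finset.prod_ite_eq',
    Finset.mem_univ, if_true]

theorem mul_two_eq_prod_pow (v : ι → ℝ) (i j : ι) : v i * v j =
    ∏ a, v a ^ ((if a = i then 1 else 0) + (if a = j then 1 else 0)) := by
  simp only [pow_add, Finset.prod_mul_distrib, pow_ite, pow_one, pow_zero, Finset.prod_ite_eq',
    Finset.mem_univ, if_true]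

theorem integrable_mul_four (hmom : ∀ k : ℕ, Integrable (fun x : ℝ => x ^ k) M) (i j k l : ι) :
    Integrable (fun v : ι → ℝ => v i * v j * v k * v l) (Measure.pi fun _ => M) := by
  simp only [mul_four_eq_prod_pow]
  exact integrable_prod_pow hmom _

theorem integrable_mul_two (hmom : ∀ k : ℕ, Integrable (fun x : ℝ => x ^ k) M) (i j : ι) :
    Integrable (fun v : ι → ℝ => v i * v j) (Measure.pi fun _ => M) := by
  simp only [mul_two_eq_prod_pow]
  exact integrable_prod_pow hmom _

theorem integral_mul_two (hmean : ∫ x, x ∂M = 0) (i j : ι) :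
    ∫ v : ι → ℝ, v i * v j ∂(Measure.pi fun _ => M) =
      (∫ x, x ^ 2 ∂M) * (if i = j then 1 else 0) := by
  simp only [mul_two_eq_prod_pow, integral_prod_pow]
  by_cases hij : i = j
  · subst hij
    rw [Finset.prod_eq_single i (fun b _ hb => by simp [hb]) (by simp)]
    simp
  · rw [Finset.prod_eq_zero (Finset.mem_univ i) (by simpa [hij] using hmean)]
    simp [hij]

/-- Fourth-order moments of independent centred variables: only index patterns consisting of two
pairs contribute. -/
theorem integral_mul_four (hmean : ∫ x, x ∂M = 0) (i j k l : ι) :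
    ∫ v : ι → ℝ, v i * v j * v k * v l ∂(Measure.pi fun _ => M) =
      (∫ x, x ^ 2 ∂M) ^ 2 * ((if i = j then 1 else 0) * (if k = l then 1 else 0) +
        (if i = k then 1 else 0) * (if j = l then 1 else 0) +
        (if i = l then 1 else 0) * (if j = k then 1 else 0)) +
      ((∫ x, x ^ 4 ∂M) - 3 * (∫ x, x ^ 2 ∂M) ^ 2) *
        ((if i = j then 1 else 0) * (if i = k then 1 else 0) * (if i = l then 1 else 0)) := by
  simp only [mul_four_eq_prod_pow, integral_prod_pow]
  have zero : ∀ (m : ι → ℕ) (a : ι), m a = 1 → ∏ a, ∫ x, x ^ m a ∂M = 0 := fun m a h =>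
    Finset.prod_eq_zero (Finset.mem_univ a) (by simpa [h] using hmean)
  have two : ∀ (m : ι → ℕ) (a b : ι), a ≠ b → m a = 2 → m b = 2 →
      (∀ c, c ≠ a → c ≠ b → m c = 0) → ∏ a, ∫ x, x ^ m a ∂M = (∫ x, x ^ 2 ∂M) ^ 2 := by
    intro m a b hab ha hb h
    rw [Finset.prod_eq_mul a b hab (fun c _ hc => by simp [h c hc.1 hc.2]) (by simp) (by simp),
      ha, hb, sq]
  by_cases hij : i = j
  · subst hij
    by_cases hkl : k = l
    · subst hkl
      by_cases hik : i = k
      · subst hik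
        rw [Finset.prod_eq_single i (fun b _ hb => by simp [hb]) (by simp)]
        simp
        ring
      · rw [two _ i k hik (by simp [hik]) (by simp [Ne.symm hik])
          (fun c hc hc' => by simp [hc, hc'])]
        simp [hik]
    · by_cases hik : i = k
      · subst hik
        rw [zero _ l (by simp [Ne.symm hkl])]
        simp [hkl]
      · rw [zero _ k (by simp [hkl, Ne.symm hik])]
        simp [hkl, hik]
  · by_cases hik : i = k
    · subst hik
      by_cases hjl : j = l
      · subst hjl
        rw [two _ i j hij (by simp [hij]) (by simp [Ne.symm hij])
          (fun c hc hc' => by simp [hc, hc'])]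
        simp [hij]
      · rw [zero _ j (by simp [Ne.symm hij, hjl])]
        simp [hij, hjl, Ne.symm hij]
    · by_cases hil : i = l
      · subst hil
        by_cases hjk : j = k
        · subst hjk
          rw [two _ i j hij (by simp [hij]) (by simp [Ne.symm hij])
            (fun c hc hc' => by simp [hc, hc'])]
          simp [hij]
        · rw [zero _ j (by simp [Ne.symm hij, hjk])]
          simp [hij, hik, hjk]
      · rw [zero _ i (by simp [hij, hik, hil])]
        simp [hij, hik, hil]

theorem integral_linear_mul_linear (hmom : ∀ k : ℕ, Integrable (fun x : ℝ => x ^ k) M)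
    (hmean : ∫ x, x ∂M = 0) (w w' : ι → ℝ) :
    ∫ v : ι → ℝ, (∑ j, w j * v j) * (∑ j, w' j * v j) ∂(Measure.pi fun _ => M) =
      (∫ x, x ^ 2 ∂M) * ∑ j, w j * w' j := by
  have e : ∀ v : ι → ℝ, (∑ j, w j * v j) * (∑ j, w' j * v j) =
      ∑ i, ∑ j, (w i * w' j) * (v i * v j) := by
    intro v
    rw [Finset.sum_mul_sum]
    exact Finset.sum_congr rfl fun i _ => Finset.sum_congr rfl fun j _ => by ring
  simp only [e]
  rw [integral_finsetSum _ fun i _ => integrable_finsetSum _ fun j _ =>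
    (integrable_mul_two hmom i j).const_mul _]
  simp only [integral_finsetSum _ fun j _ => (integrable_mul_two hmom _ j).const_mul _,
    integral_const_mul, integral_mul_two hmean]
  rw [Finset.mul_sum]
  simp
  exact Finset.sum_congr rfl fun i _ => by ring

/-- The second moment of a quadratic form in independent centred variables. -/
theorem integral_quadratic_sq (hmom : ∀ k : ℕ, Integrable (fun x : ℝ => x ^ k) M)
    (hmean : ∫ x, x ∂M = 0) (B : ι → ι → ℝ) :
    ∫ v : ι → ℝ, (∑ i, ∑ j, B i j * (v i * v j)) ^ 2 ∂(Measure.pi fun _ => M) =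
      (∫ x, x ^ 2 ∂M) ^ 2 * ((∑ i, B i i) ^ 2 + ∑ i, ∑ j, B i j ^ 2 + ∑ i, ∑ j, B i j * B j i) +
      ((∫ x, x ^ 4 ∂M) - 3 * (∫ x, x ^ 2 ∂M) ^ 2) * ∑ i, B i i ^ 2 := by
  have e : ∀ v : ι → ℝ, (∑ i, ∑ j, B i j * (v i * v j)) ^ 2 =
      ∑ i, ∑ j, ∑ k, ∑ l, (B i j * B k l) * (v i * v j * v k * v l) := by
    intro v
    rw [sq, Finset.sum_mul]
    refine Finset.sum_congr rfl fun i _ => ?_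
    rw [Finset.sum_mul]
    refine Finset.sum_congr rfl fun j _ => ?_
    rw [Finset.mul_sum]
    refine Finset.sum_congr rfl fun k _ => ?_
    rw [Finset.mul_sum]
    exact Finset.sum_congr rfl fun l _ => by ring
  have hi : ∀ i j k l : ι, Integrable (fun v : ι → ℝ =>
      (B i j * B k l) * (v i * v j * v k * v l)) (Measure.pi fun _ => M) :=
    fun i j k l => (integrable_mul_four hmom i j k l).const_mul _
  have hi1 := fun i j k => integrable_finsetSum Finset.univ fun l _ => hi i j k l
  have hi2 := fun i j => integrable_finsetSum Finset.univ fun k _ => hi1 i j k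
  have hi3 := fun i => integrable_finsetSum Finset.univ fun j _ => hi2 i j
  simp only [e]
  rw [integral_finsetSum _ fun i _ => hi3 i]
  simp only [integral_finsetSum _ fun j _ => hi2 _ j]
  simp only [integral_finsetSum _ fun k _ => hi1 _ _ k]
  simp only [integral_finsetSum _ fun l _ => hi _ _ _ l, integral_const_mul,
    integral_mul_four hmean]
  set s2 := ∫ x, x ^ 2 ∂M
  set s4 := ∫ x, x ^ 4 ∂M
  have h1 : ∑ i, ∑ j, ∑ k, ∑ l, B i j * B k l * ((if i = j then 1 else 0) *
      (if k = l then 1 else 0)) = (∑ i, B i i) ^ 2 := by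
    simp [sq, Finset.sum_mul_sum]
  have h2 : ∑ i, ∑ j, ∑ k, ∑ l, B i j * B k l * ((if i = k then 1 else 0) *
      (if j = l then 1 else 0)) = ∑ i, ∑ j, B i j ^ 2 := by
    simp [sq]
  have h3 : ∑ i, ∑ j, ∑ k, ∑ l, B i j * B k l * ((if i = l then 1 else 0) *
      (if j = k then 1 else 0)) = ∑ i, ∑ j, B i j * B j i := by
    simp
  have h4 : ∑ i, ∑ j, ∑ k, ∑ l, B i j * B k l * ((if i = j then 1 else 0) *
      (if i = k then 1 else 0) * (if i = l then 1 else 0)) = ∑ i, B i i ^ 2 := by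
    simp [sq]
  rw [← h1, ← h2, ← h3, ← h4]
  simp only [Finset.mul_sum, ← Finset.sum_add_distrib]
  refine Finset.sum_congr rfl fun i _ => Finset.sum_congr rfl fun j _ =>
    Finset.sum_congr rfl fun k _ => Finset.sum_congr rfl fun l _ => ?_
  ring

/-- A quadratic form with symmetric coefficients is bounded below in mean square, because the law has
a strictly larger fourth moment than a symmetric Bernoulli law of the same variance. -/
theorem mul_sum_sq_le_integral_quadratic_sq
    (hmom : ∀ k : ℕ, Integrable (fun x : ℝ => x ^ k) M) (hmean : ∫ x, x ∂M = 0) {β : ℝ}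
    (h2 : β ≤ 2 * (∫ x, x ^ 2 ∂M) ^ 2)
    (h4 : (∫ x, x ^ 2 ∂M) ^ 2 + β ≤ ∫ x, x ^ 4 ∂M)
    (B : ι → ι → ℝ) (hB : ∀ i j, B i j = B j i) :
    β * ∑ i, ∑ j, B i j ^ 2 ≤
      ∫ v : ι → ℝ, (∑ i, ∑ j, B i j * (v i * v j)) ^ 2 ∂(Measure.pi fun _ => M) := by
  rw [integral_quadratic_sq hmom hmean]
  have e : ∑ i, ∑ j, B i j * B j i = ∑ i, ∑ j, B i j ^ 2 :=
    Finset.sum_congr rfl fun i _ => Finset.sum_congr rfl fun j _ => by rw [hB j i]; ring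
  have hd : ∑ i, B i i ^ 2 ≤ ∑ i, ∑ j, B i j ^ 2 :=
    Finset.sum_le_sum fun i _ =>
      Finset.single_le_sum (f := fun j => B i j ^ 2) (fun j _ => sq_nonneg _) (Finset.mem_univ i)
  have hd0 : 0 ≤ ∑ i, B i i ^ 2 := Finset.sum_nonneg fun i _ => sq_nonneg _
  rw [e]
  nlinarith [mul_nonneg (sub_nonneg.2 h2) (sub_nonneg.2 hd), mul_nonneg (sub_nonneg.2 h4) hd0,
    mul_nonneg (sq_nonneg (∫ x, x ^ 2 ∂M)) (sq_nonneg (∑ i, B i i))]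

end Product

/-! ### Amplitudes of measurement vectors -/

section Amplitudes

variable {𝕜 : Type*} [RCLike 𝕜] {d : ℕ}

/-- The amplitude `a^* u`, as a real-linear function of `u`. -/
noncomputable def amp (a : Fin d → 𝕜) : EuclideanSpace 𝕜 (Fin d) →ₗ[ℝ] 𝕜 where
  toFun u := star a ⬝ᵥ u.ofLp
  map_add' u v := by simp [dotProduct_add]
  map_smul' c u := by simp [dotProduct_smul]

theorem amp_apply (a : Fin d → 𝕜) (u : EuclideanSpace 𝕜 (Fin d)) :
    amp a u = star a ⬝ᵥ u.ofLp := rfl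

/-- The real symmetric form `(u, v) ↦ Re (conj (a^* u) (a^* v))` polarizing `|a^* u|²`. -/
noncomputable def crossForm (a : Fin d → 𝕜) : LinearMap.BilinForm ℝ (EuclideanSpace 𝕜 (Fin d)) :=
  LinearMap.mk₂ ℝ (fun u v => RCLike.re (star (amp a u) * amp a v))
    (fun u u' v => by simp [add_mul]) (fun c u v => by simp [RCLike.smul_re])
    (fun u v v' => by simp [mul_add]) (fun c u v => by simp [RCLike.smul_re])

theorem crossForm_apply (a : Fin d → 𝕜) (u v : EuclideanSpace 𝕜 (Fin d)) :
    crossForm a u v = RCLike.re (amp a u) * RCLike.re (amp a v) +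
      RCLike.im (amp a u) * RCLike.im (amp a v) := by
  simp [crossForm, RCLike.mul_re]

theorem crossForm_symm (a : Fin d → 𝕜) (u v : EuclideanSpace 𝕜 (Fin d)) :
    crossForm a u v = crossForm a v u := by
  simp only [crossForm_apply]; ring

theorem norm_sq_eq_re_im (z : 𝕜) : ‖z‖ ^ 2 = RCLike.re z ^ 2 + RCLike.im z ^ 2 := by
  rw [RCLike.norm_sq_eq_def]; ring

theorem crossForm_self (a : Fin d → 𝕜) (u : EuclideanSpace 𝕜 (Fin d)) :
    crossForm a u u = ‖amp a u‖ ^ 2 := by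
  rw [crossForm_apply, norm_sq_eq_re_im]; ring

theorem abs_crossForm_le (a : Fin d → 𝕜) (u v : EuclideanSpace 𝕜 (Fin d)) :
    |crossForm a u v| ≤ ‖amp a u‖ * ‖amp a v‖ := by
  have : crossForm a u v = RCLike.re (star (amp a u) * amp a v) := rfl
  rw [this]
  refine (RCLike.abs_re_le_norm _).trans (by simp)

theorem norm_amp_le (a : Fin d → 𝕜) (u : EuclideanSpace 𝕜 (Fin d)) :
    ‖amp a u‖ ≤ ‖WithLp.toLp 2 a‖ * ‖u‖ := by
  have h := norm_inner_le_norm (𝕜 := 𝕜) (WithLp.toLp 2 a) u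
  rwa [EuclideanSpace.inner_eq_star_dotProduct, dotProduct_comm] at h

@[fun_prop]
theorem continuous_amp (u : EuclideanSpace 𝕜 (Fin d)) : Continuous fun a : Fin d → 𝕜 => amp a u := by
  simp only [amp_apply, dotProduct, Pi.star_apply]
  fun_prop

@[fun_prop]
theorem measurable_amp (u : EuclideanSpace 𝕜 (Fin d)) : Measurable fun a : Fin d → 𝕜 => amp a u :=
  (continuous_amp u).measurable

@[fun_prop]
theorem measurable_crossForm (u v : EuclideanSpace 𝕜 (Fin d)) :
    Measurable fun a : Fin d → 𝕜 => crossForm a u v := by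
  simp only [crossForm_apply]
  exact Continuous.measurable (by fun_prop)

/-- The coefficients of `Re (a^* u)` as a linear form in the real coordinates of `a`. -/
noncomputable def reCoeff (u : EuclideanSpace 𝕜 (Fin d)) : Fin d ⊕ Fin d → ℝ :=
  Sum.elim (fun i => RCLike.re (u i)) (fun i => RCLike.im (u i))

/-- The coefficients of `Im (a^* u)` as a linear form in the real coordinates of `a`. The factor
`RCLike.im RCLike.I` is `1` over `ℂ` and `0` over `ℝ`. -/
noncomputable def imCoeff (u : EuclideanSpace 𝕜 (Fin d)) : Fin d ⊕ Fin d → ℝ :=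
  Sum.elim (fun i => RCLike.im (u i))
    (fun i => -(RCLike.im (RCLike.I : 𝕜) * RCLike.re (u i)))

theorem re_amp_ofRealCoords (v : Fin d ⊕ Fin d → ℝ) (u : EuclideanSpace 𝕜 (Fin d)) :
    RCLike.re (amp (ofRealCoords 𝕜 d v) u) = ∑ j, reCoeff u j * v j := by
  simp only [amp_apply, dotProduct, Pi.star_apply, ofRealCoords, map_sum, Fintype.sum_sum_type,
    ← Finset.sum_add_distrib]
  refine Finset.sum_congr rfl fun i _ => ?_
  simp [RCLike.mul_re, RCLike.mul_im, reCoeff]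
  have := RCLike.mul_im_I_ax (u i)
  linear_combination v (Sum.inr i) * this

theorem im_amp_ofRealCoords (v : Fin d ⊕ Fin d → ℝ) (u : EuclideanSpace 𝕜 (Fin d)) :
    RCLike.im (amp (ofRealCoords 𝕜 d v) u) = ∑ j, imCoeff u j * v j := by
  simp only [amp_apply, dotProduct, Pi.star_apply, ofRealCoords, map_sum, Fintype.sum_sum_type,
    ← Finset.sum_add_distrib]
  refine Finset.sum_congr rfl fun i _ => ?_
  simp [RCLike.mul_re, RCLike.mul_im, imCoeff]
  ring

theorem norm_sq_eq_sum_re_im (u : EuclideanSpace 𝕜 (Fin d)) :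
    ‖u‖ ^ 2 = ∑ i, (RCLike.re (u i) ^ 2 + RCLike.im (u i) ^ 2) := by
  rw [EuclideanSpace.norm_sq_eq]
  exact Finset.sum_congr rfl fun i _ => by rw [norm_sq_eq_re_im]

theorem sum_reCoeff_sq (u : EuclideanSpace 𝕜 (Fin d)) : ∑ j, reCoeff u j ^ 2 = ‖u‖ ^ 2 := by
  rw [norm_sq_eq_sum_re_im]
  simp [reCoeff, Fintype.sum_sum_type, Finset.sum_add_distrib]

theorem sum_imCoeff_sq (u : EuclideanSpace 𝕜 (Fin d)) :
    ∑ j, imCoeff u j ^ 2 = RCLike.im (RCLike.I : 𝕜) ^ 2 * ‖u‖ ^ 2 := by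
  rw [norm_sq_eq_sum_re_im, Finset.mul_sum]
  simp only [imCoeff, Fintype.sum_sum_type, ← Finset.sum_add_distrib, Sum.elim_inl, Sum.elim_inr]
  refine Finset.sum_congr rfl fun i _ => ?_
  have := RCLike.mul_im_I_ax (u i)
  linear_combination -(RCLike.im (u i) + RCLike.im (u i) * RCLike.im (RCLike.I : 𝕜)) * this

theorem sq_im_I_le_one : RCLike.im (RCLike.I : 𝕜) ^ 2 ≤ 1 := by
  have h := RCLike.abs_im_le_norm (RCLike.I : 𝕜)
  have h2 : ‖(RCLike.I : 𝕜)‖ ≤ 1 := by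
    rcases eq_or_ne (RCLike.I : 𝕜) 0 with h | h
    · simp [h]
    · rw [RCLike.norm_I_of_ne_zero h]
  rw [← sq_abs]
  nlinarith [abs_nonneg (RCLike.im (RCLike.I : 𝕜))]

/-- The coupling of real and imaginary coefficients is an imaginary part, so it vanishes for pairs with
real inner product. -/
theorem sum_reCoeff_mul_imCoeff (p q : EuclideanSpace 𝕜 (Fin d)) :
    ∑ j, reCoeff p j * imCoeff q j = RCLike.im (inner 𝕜 p q) := by
  rw [PiLp.inner_apply, map_sum]
  simp only [reCoeff, imCoeff, Fintype.sum_sum_type, ← Finset.sum_add_distrib, Sum.elim_inl,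
    Sum.elim_inr]
  refine Finset.sum_congr rfl fun i _ => ?_
  have := RCLike.mul_im_I_ax (p i)
  simp [RCLike.mul_im]
  linear_combination -(RCLike.re (q i)) * this

/-- The symmetric coefficient matrix of `crossForm a p q` as a quadratic form in the real coordinates
of `a`. -/
noncomputable def crossCoeff (p q : EuclideanSpace 𝕜 (Fin d)) (i j : Fin d ⊕ Fin d) : ℝ :=
  (reCoeff p i * reCoeff q j + reCoeff q i * reCoeff p j +
    (imCoeff p i * imCoeff q j + imCoeff q i * imCoeff p j)) / 2

theorem crossForm_ofRealCoords (v : Fin d ⊕ Fin d → ℝ) (p q : EuclideanSpace 𝕜 (Fin d)) :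
    crossForm (ofRealCoords 𝕜 d v) p q = ∑ i, ∑ j, crossCoeff p q i j * (v i * v j) := by
  have h : ∀ a b : Fin d ⊕ Fin d → ℝ, (∑ j, a j * v j) * (∑ j, b j * v j) =
      ∑ i, ∑ j, a i * b j * (v i * v j) := by
    intro a b
    rw [Finset.sum_mul_sum]
    exact Finset.sum_congr rfl fun i _ => Finset.sum_congr rfl fun j _ => by ring
  have h' : ∀ a b : Fin d ⊕ Fin d → ℝ, (∑ j, a j * v j) * (∑ j, b j * v j) =
      (∑ i, ∑ j, a i * b j * (v i * v j) + ∑ i, ∑ j, b i * a j * (v i * v j)) / 2 := by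
    intro a b
    rw [← h, ← h]; ring
  rw [crossForm_apply]
  simp only [re_amp_ofRealCoords, im_amp_ofRealCoords, h', ← Finset.sum_add_distrib,
    Finset.sum_div]
  exact Finset.sum_congr rfl fun i _ => Finset.sum_congr rfl fun j _ => by
    simp only [crossCoeff]; ring

/-- For unit vectors `p`, `q` with real inner product, the Hermitian matrix `(p q^* + q p^*) / 2` has
squared Frobenius norm at least `1 / 2`. -/
theorem half_le_sum_crossCoeff_sq {p q : EuclideanSpace 𝕜 (Fin d)} (hp : ‖p‖ = 1) (hq : ‖q‖ = 1)
    (hpq : RCLike.im (inner 𝕜 p q) = 0) : 1 / 2 ≤ ∑ i, ∑ j, crossCoeff p q i j ^ 2 := by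
  have key : ∀ a b c e : Fin d ⊕ Fin d → ℝ,
      ∑ i, ∑ j, ((a i * b j + b i * a j + (c i * e j + e i * c j)) / 2) ^ 2 =
      ((∑ i, a i ^ 2) * (∑ i, b i ^ 2) + (∑ i, a i * b i) ^ 2) / 2 +
      ((∑ i, c i ^ 2) * (∑ i, e i ^ 2) + (∑ i, c i * e i) ^ 2) / 2 +
      ((∑ i, a i * c i) * (∑ i, b i * e i) + (∑ i, a i * e i) * (∑ i, b i * c i)) := by
    intro a b c e
    have e1 : ((∑ i, a i ^ 2) * (∑ i, b i ^ 2) + (∑ i, a i * b i) ^ 2) / 2 +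
        ((∑ i, c i ^ 2) * (∑ i, e i ^ 2) + (∑ i, c i * e i) ^ 2) / 2 +
        ((∑ i, a i * c i) * (∑ i, b i * e i) + (∑ i, a i * e i) * (∑ i, b i * c i)) =
        ((∑ i, a i ^ 2) * (∑ i, b i ^ 2) + (∑ i, b i ^ 2) * (∑ i, a i ^ 2) +
          2 * ((∑ i, a i * b i) * (∑ i, a i * b i)) +
          ((∑ i, c i ^ 2) * (∑ i, e i ^ 2) + (∑ i, e i ^ 2) * (∑ i, c i ^ 2) +
          2 * ((∑ i, c i * e i) * (∑ i, c i * e i))) +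
          2 * ((∑ i, a i * c i) * (∑ i, b i * e i) + (∑ i, b i * e i) * (∑ i, a i * c i) +
            ((∑ i, a i * e i) * (∑ i, b i * c i) + (∑ i, b i * c i) * (∑ i, a i * e i)))) / 4 := by
      ring
    rw [e1]
    simp only [Finset.sum_mul_sum]
    simp only [Finset.mul_sum, ← Finset.sum_add_distrib, Finset.sum_div]
    exact Finset.sum_congr rfl fun i _ => Finset.sum_congr rfl fun j _ => by ring
  have hpp : RCLike.im (inner 𝕜 p p) = 0 := by simp
  simp only [crossCoeff]
  rw [key, sum_reCoeff_mul_imCoeff p p, sum_reCoeff_mul_imCoeff p q, hpq, hpp, sum_reCoeff_sq,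
    sum_reCoeff_sq, sum_imCoeff_sq, sum_imCoeff_sq, hp, hq]
  nlinarith [sq_nonneg (∑ i, reCoeff p i * reCoeff q i), sq_nonneg (∑ i, imCoeff p i * imCoeff q i),
    sq_nonneg (RCLike.im (RCLike.I : 𝕜) ^ 2)]

theorem measurable_ofRealCoords : Measurable (ofRealCoords 𝕜 d) := by
  refine measurable_pi_lambda _ fun i => ?_
  simp only [ofRealCoords]
  exact Continuous.measurable (by fun_prop)

instance {M : Measure ℝ} [IsProbabilityMeasure M] :
    IsProbabilityMeasure (measurementLaw 𝕜 d M) :=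
  Measure.isProbabilityMeasure_map measurable_ofRealCoords.aemeasurable

theorem integral_measurementLaw {M : Measure ℝ} {g : (Fin d → 𝕜) → ℝ} (hg : Measurable g) :
    ∫ a, g a ∂(measurementLaw 𝕜 d M) =
      ∫ v, g (ofRealCoords 𝕜 d v) ∂(Measure.pi fun _ => M) :=
  integral_map measurable_ofRealCoords.aemeasurable hg.aestronglyMeasurable

/-- The features of the law `μ` of a measurement vector used for the empirical process: amplitudes are
uniformly sub-Gaussian and isotropic, and the forms `crossForm a p q` do not degenerate in mean. -/
structure IsRegularLaw (μ : Measure (Fin d → 𝕜)) (c s m : ℝ) : Prop where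
  integrable_exp : ∀ u : EuclideanSpace 𝕜 (Fin d), ‖u‖ ≤ 1 →
    Integrable (fun a => Real.exp (c * ‖amp a u‖ ^ 2)) μ
  integral_exp_le : ∀ u : EuclideanSpace 𝕜 (Fin d), ‖u‖ ≤ 1 →
    ∫ a, Real.exp (c * ‖amp a u‖ ^ 2) ∂μ ≤ 2
  integral_sq : ∀ u : EuclideanSpace 𝕜 (Fin d), ∫ a, ‖amp a u‖ ^ 2 ∂μ = s * ‖u‖ ^ 2
  le_integral_abs : ∀ p q : EuclideanSpace 𝕜 (Fin d), ‖p‖ = 1 → ‖q‖ = 1 →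
    RCLike.im (inner 𝕜 p q) = 0 → m ≤ ∫ a, |crossForm a p q| ∂μ

section Law

variable {μ : Measure (Fin d → 𝕜)} {c : ℝ} {u p q : EuclideanSpace 𝕜 (Fin d)}

theorem integrable_norm_amp_pow (hc : 0 < c)
    (hint : Integrable (fun a => Real.exp (c * ‖amp a u‖ ^ 2)) μ) (k : ℕ) :
    Integrable (fun a => ‖amp a u‖ ^ (2 * k)) μ := by
  refine Integrable.mono' (hint.const_mul ((c ^ k)⁻¹ * k.factorial)) (by fun_prop)
    (ae_of_all _ fun a => ?_)
  have h := pow_le_factorial_mul_exp (x := c * ‖amp a u‖ ^ 2) (by positivity) k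
  rw [mul_pow, ← pow_mul] at h
  rw [Real.norm_of_nonneg (by positivity), mul_assoc, le_inv_mul_iff₀ (by positivity)]
  exact h

theorem integral_norm_amp_pow_le (hc : 0 < c)
    (hint : Integrable (fun a => Real.exp (c * ‖amp a u‖ ^ 2)) μ)
    (hle : ∫ a, Real.exp (c * ‖amp a u‖ ^ 2) ∂μ ≤ 2) (k : ℕ) :
    ∫ a, ‖amp a u‖ ^ (2 * k) ∂μ ≤ 2 * k.factorial / c ^ k := by
  calc ∫ a, ‖amp a u‖ ^ (2 * k) ∂μ
      ≤ ∫ a, (c ^ k)⁻¹ * k.factorial * Real.exp (c * ‖amp a u‖ ^ 2) ∂μ := by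
        refine integral_mono (integrable_norm_amp_pow hc hint k) (hint.const_mul _) fun a => ?_
        have h := pow_le_factorial_mul_exp (x := c * ‖amp a u‖ ^ 2) (by positivity) k
        rw [mul_pow, ← pow_mul] at h
        simp only []
        rw [mul_assoc, le_inv_mul_iff₀ (by positivity)]
        exact h
    _ ≤ (c ^ k)⁻¹ * k.factorial * 2 := by
        rw [integral_const_mul]; gcongr
    _ = _ := by rw [div_eq_mul_inv]; ring

theorem abs_crossForm_pow_le (a : Fin d → 𝕜) (k : ℕ) :
    |crossForm a p q| ^ k ≤ (‖amp a p‖ ^ (2 * k) + ‖amp a q‖ ^ (2 * k)) / 2 := by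
  have h : |crossForm a p q| ^ k ≤ ‖amp a p‖ ^ k * ‖amp a q‖ ^ k := by
    rw [← mul_pow]
    exact pow_le_pow_left₀ (abs_nonneg _) (abs_crossForm_le a p q) k
  have e : ∀ x : ℝ, x ^ (2 * k) = (x ^ k) ^ 2 := fun x => by rw [← pow_mul, mul_comm]
  rw [e, e]
  nlinarith [sq_nonneg (‖amp a p‖ ^ k - ‖amp a q‖ ^ k)]

theorem integrable_abs_crossForm_pow (hc : 0 < c)
    (hp : Integrable (fun a => Real.exp (c * ‖amp a p‖ ^ 2)) μ)
    (hq : Integrable (fun a => Real.exp (c * ‖amp a q‖ ^ 2)) μ) (k : ℕ) :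
    Integrable (fun a => |crossForm a p q| ^ k) μ := by
  refine Integrable.mono' (((integrable_norm_amp_pow hc hp k).add
    (integrable_norm_amp_pow hc hq k)).div_const 2)
    (((measurable_crossForm p q).abs.pow_const k).aestronglyMeasurable) (ae_of_all _ fun a => ?_)
  rw [Real.norm_of_nonneg (by positivity)]
  exact abs_crossForm_pow_le a k

theorem integral_abs_crossForm_pow_le (hc : 0 < c)
    (hp : Integrable (fun a => Real.exp (c * ‖amp a p‖ ^ 2)) μ)
    (hq : Integrable (fun a => Real.exp (c * ‖amp a q‖ ^ 2)) μ)
    (hp2 : ∫ a, Real.exp (c * ‖amp a p‖ ^ 2) ∂μ ≤ 2)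
    (hq2 : ∫ a, Real.exp (c * ‖amp a q‖ ^ 2) ∂μ ≤ 2) (k : ℕ) :
    ∫ a, |crossForm a p q| ^ k ∂μ ≤ 2 * k.factorial / c ^ k := by
  have hip := integrable_norm_amp_pow hc hp k
  have hiq := integrable_norm_amp_pow hc hq k
  calc ∫ a, |crossForm a p q| ^ k ∂μ
      ≤ ∫ a, (‖amp a p‖ ^ (2 * k) + ‖amp a q‖ ^ (2 * k)) / 2 ∂μ :=
        integral_mono (integrable_abs_crossForm_pow hc hp hq k) ((hip.add hiq).div_const 2)
          fun a => abs_crossForm_pow_le a k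
    _ = (∫ a, ‖amp a p‖ ^ (2 * k) ∂μ + ∫ a, ‖amp a q‖ ^ (2 * k) ∂μ) / 2 := by
        rw [integral_div, integral_add hip hiq]
    _ ≤ _ := by
        have := integral_norm_amp_pow_le hc hp hp2 k
        have := integral_norm_amp_pow_le hc hq hq2 k
        linarith

/-- A first-moment lower bound from a second-moment lower bound and a fourth-moment upper bound. -/
theorem le_integral_abs_crossForm (hc : 0 < c)
    (hp : Integrable (fun a => Real.exp (c * ‖amp a p‖ ^ 2)) μ)
    (hq : Integrable (fun a => Real.exp (c * ‖amp a q‖ ^ 2)) μ)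
    (hp2 : ∫ a, Real.exp (c * ‖amp a p‖ ^ 2) ∂μ ≤ 2)
    (hq2 : ∫ a, Real.exp (c * ‖amp a q‖ ^ 2) ∂μ ≤ 2) {β : ℝ} (hβ : 0 < β)
    (h : β ≤ ∫ a, crossForm a p q ^ 2 ∂μ) :
    β / 2 / √(96 / (c ^ 4 * β)) ≤ ∫ a, |crossForm a p q| ∂μ := by
  have hi := integrable_abs_crossForm_pow hc hp hq
  have h4 := integral_abs_crossForm_pow_le hc hp hq hp2 hq2 4
  -- Truncation level at which the fourth moment contributes at most `β / 2`.
  set T := √(96 / (c ^ 4 * β)) with hT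
  have hT0 : 0 < T := Real.sqrt_pos.2 (by positivity)
  have hT2 : T ^ 2 = 96 / (c ^ 4 * β) := Real.sq_sqrt (by positivity)
  have hpt : ∀ y : ℝ, 0 ≤ y → y ^ 2 ≤ T * y ^ 1 + (T ^ 2)⁻¹ * y ^ 4 := by
    intro y hy
    rcases le_total y T with hyT | hyT
    · have : 0 ≤ (T ^ 2)⁻¹ * y ^ 4 := by positivity
      nlinarith
    · have h1 : y ^ 2 ≤ (T ^ 2)⁻¹ * y ^ 4 := by
        rw [le_inv_mul_iff₀ (by positivity)]
        have : T ^ 2 ≤ y ^ 2 := by gcongr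
        nlinarith [sq_nonneg y]
      have : 0 ≤ T * y ^ 1 := by positivity
      linarith
  have hm : ∫ a, crossForm a p q ^ 2 ∂μ ≤
      T * ∫ a, |crossForm a p q| ^ 1 ∂μ + (T ^ 2)⁻¹ * ∫ a, |crossForm a p q| ^ 4 ∂μ := by
    rw [← integral_const_mul, ← integral_const_mul,
      ← integral_add ((hi 1).const_mul _) ((hi 4).const_mul _)]
    refine integral_mono ?_ (((hi 1).const_mul _).add ((hi 4).const_mul _)) fun a => ?_
    · simpa using hi 2
    · have := hpt |crossForm a p q| (abs_nonneg _)
      rwa [sq_abs] at this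
  have h5 : (T ^ 2)⁻¹ * ∫ a, |crossForm a p q| ^ 4 ∂μ ≤ β / 2 := by
    calc (T ^ 2)⁻¹ * ∫ a, |crossForm a p q| ^ 4 ∂μ
        ≤ (T ^ 2)⁻¹ * (2 * (4 : ℕ).factorial / c ^ 4) := by gcongr
      _ = β / 2 := by
        rw [hT2]
        simp [Nat.factorial]
        field_simp
        norm_num
  rw [div_le_iff₀ hT0]
  simp only [pow_one] at hm
  nlinarith

end Law

/-- The constants `c` and `m` are uniform in the dimension and in the entry distribution; only the
second moment `s` of an amplitude depends on the latter. -/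
theorem exists_isRegularLaw (𝕜 : Type*) [RCLike 𝕜] (K : ℝ≥0) {κ : ℝ} (hκ : 0 < κ) :
    ∃ c m : ℝ, 0 < c ∧ 0 < m ∧ ∀ (M : Measure ℝ), IsProbabilityMeasure M → ∫ t, t ∂M = 0 →
      subGaussianNorm (fun t : ℝ => t) M ≤ K →
      (∫ t, t ^ 2 ∂M) ^ 2 + κ ≤ ∫ t, t ^ 4 ∂M →
      ∀ d : ℕ, ∃ s : ℝ, IsRegularLaw (measurementLaw 𝕜 d M) c s m := by
  set t : ℝ := (K : ℝ) + 1 with ht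
  have ht0 : 0 < t := by positivity
  set c : ℝ := 1 / (16 * t ^ 2) with hc
  have hc0 : 0 < c := by positivity
  set β : ℝ := min κ (2 * (κ ^ 2 / (48 * t ^ 6)) ^ 2) with hβ
  have hβ0 : 0 < β := lt_min hκ (by positivity)
  refine ⟨c, β / 2 / 2 / √(96 / (c ^ 4 * (β / 2))), hc0,
    div_pos (by positivity) (Real.sqrt_pos.2 (by positivity)), ?_⟩
  intro M hM hmean hsub h4 d
  obtain ⟨hint, h2⟩ := integrable_exp_sq_of_subGaussianNorm_le hsub
  have hmom := integrable_pow_of_integrable_exp_sq ht0 hint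
  have hexp := integrable_exp_mul_of_integrable_exp_sq ht0 hint
  have hle := integral_exp_mul_le ht0 hint h2 hmean
  have hvar := sq_div_le_integral_sq ht0 hint h2 hκ
    (by nlinarith [sq_nonneg (∫ t, t ^ 2 ∂M)] : κ ≤ ∫ x, x ^ 4 ∂M)
  -- A linear form with coefficients of norm at most one is sub-Gaussian with constant `t`.
  have hlin : ∀ w : Fin d ⊕ Fin d → ℝ, ∑ j, w j ^ 2 ≤ 1 →
      ∫⁻ v, ENNReal.ofReal (Real.exp (2 * c * (∑ j, w j * v j) ^ 2)) ∂(Measure.pi fun _ => M) ≤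
        ENNReal.ofReal 2 := by
    intro w hw
    refine lintegral_exp_mul_sq_le (b := t ^ 2) (by fun_prop) (by positivity) ?_
      (integrable_exp_linear hexp w) fun l => (integral_exp_linear_le hle w l).trans ?_
    · rw [hc]; field_simp; norm_num
    · refine Real.exp_le_exp.2 ?_
      have : 0 ≤ t ^ 2 * l ^ 2 := by positivity
      nlinarith
  have hlint : ∀ u : EuclideanSpace 𝕜 (Fin d), ‖u‖ ≤ 1 →
      ∫⁻ a, ENNReal.ofReal (Real.exp (c * ‖amp a u‖ ^ 2)) ∂(measurementLaw 𝕜 d M) ≤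
        ENNReal.ofReal 2 := by
    intro u hu
    have hu2 : ‖u‖ ^ 2 ≤ 1 := pow_le_one₀ (norm_nonneg _) hu
    rw [measurementLaw, lintegral_map (by fun_prop) measurable_ofRealCoords]
    calc ∫⁻ v, ENNReal.ofReal (Real.exp (c * ‖amp (ofRealCoords 𝕜 d v) u‖ ^ 2))
          ∂(Measure.pi fun _ => M)
        ≤ ∫⁻ v, (ENNReal.ofReal (1 / 2) *
            ENNReal.ofReal (Real.exp (2 * c * (∑ j, reCoeff u j * v j) ^ 2)) +
            ENNReal.ofReal (1 / 2) *
            ENNReal.ofReal (Real.exp (2 * c * (∑ j, imCoeff u j * v j) ^ 2)))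
            ∂(Measure.pi fun _ => M) := by
          refine lintegral_mono fun v => ?_
          rw [← ENNReal.ofReal_mul (by norm_num), ← ENNReal.ofReal_mul (by norm_num),
            ← ENNReal.ofReal_add (by positivity) (by positivity)]
          refine ENNReal.ofReal_le_ofReal ?_
          rw [norm_sq_eq_re_im, re_amp_ofRealCoords, im_amp_ofRealCoords]
          set x := ∑ j, reCoeff u j * v j
          set y := ∑ j, imCoeff u j * v j
          have e1 : Real.exp (2 * c * x ^ 2) = Real.exp (c * x ^ 2) ^ 2 := by
            rw [← Real.exp_nat_mul]; congr 1; push_cast; ring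
          have e2 : Real.exp (2 * c * y ^ 2) = Real.exp (c * y ^ 2) ^ 2 := by
            rw [← Real.exp_nat_mul]; congr 1; push_cast; ring
          have e3 : Real.exp (c * (x ^ 2 + y ^ 2)) = Real.exp (c * x ^ 2) * Real.exp (c * y ^ 2) := by
            rw [← Real.exp_add, mul_add]
          rw [e1, e2, e3]
          nlinarith [sq_nonneg (Real.exp (c * x ^ 2) - Real.exp (c * y ^ 2))]
      _ ≤ ENNReal.ofReal (1 / 2) * ENNReal.ofReal 2 + ENNReal.ofReal (1 / 2) * ENNReal.ofReal 2 := by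
          rw [lintegral_add_left (by fun_prop), lintegral_const_mul _ (by fun_prop),
            lintegral_const_mul _ (by fun_prop)]
          gcongr
          · exact hlin _ (by rw [sum_reCoeff_sq]; exact hu2)
          · refine hlin _ ?_
            rw [sum_imCoeff_sq]
            nlinarith [sq_im_I_le_one (𝕜 := 𝕜), sq_nonneg ‖u‖]
      _ = ENNReal.ofReal 2 := by
          rw [← ENNReal.ofReal_mul (by norm_num), ← ENNReal.ofReal_add (by norm_num) (by norm_num)]
          norm_num
  have hI : ∀ u : EuclideanSpace 𝕜 (Fin d), ‖u‖ ≤ 1 →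
      Integrable (fun a => Real.exp (c * ‖amp a u‖ ^ 2)) (measurementLaw 𝕜 d M) := by
    intro u hu
    refine ⟨by fun_prop, ?_⟩
    rw [hasFiniteIntegral_iff_ofReal (ae_of_all _ fun x => (Real.exp_pos _).le)]
    exact (hlint u hu).trans_lt ENNReal.ofReal_lt_top
  have hI2 : ∀ u : EuclideanSpace 𝕜 (Fin d), ‖u‖ ≤ 1 →
      ∫ a, Real.exp (c * ‖amp a u‖ ^ 2) ∂(measurementLaw 𝕜 d M) ≤ 2 := by
    intro u hu
    rw [integral_eq_lintegral_of_nonneg_ae (ae_of_all _ fun x => (Real.exp_pos _).le) (by fun_prop)]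
    exact ENNReal.toReal_le_of_le_ofReal (by norm_num) (hlint u hu)
  refine ⟨(∫ x, x ^ 2 ∂M) * (1 + RCLike.im (RCLike.I : 𝕜) ^ 2), hI, hI2, ?_, ?_⟩
  · intro u
    rw [integral_measurementLaw (by fun_prop)]
    have hx := integral_linear_mul_linear hmom hmean (reCoeff u) (reCoeff u)
    have hy := integral_linear_mul_linear hmom hmean (imCoeff u) (imCoeff u)
    have hii : ∀ w : Fin d ⊕ Fin d → ℝ, Integrable (fun v : Fin d ⊕ Fin d → ℝ =>
        (∑ j, w j * v j) * (∑ j, w j * v j)) (Measure.pi fun _ => M) := by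
      intro w
      simp only [Finset.sum_mul_sum]
      refine integrable_finsetSum _ fun i _ => integrable_finsetSum _ fun j _ => ?_
      refine ((integrable_mul_two hmom i j).const_mul (w i * w j)).congr (ae_of_all _ fun v => ?_)
      simp only []; ring
    simp only [norm_sq_eq_re_im, re_amp_ofRealCoords, im_amp_ofRealCoords]
    simp only [sq (∑ j, reCoeff u j * _), sq (∑ j, imCoeff u j * _)]
    rw [integral_add (hii _) (hii _), hx, hy]
    simp only [← sq]
    rw [sum_reCoeff_sq, sum_imCoeff_sq]
    ring
  · intro p q hp hq hpq
    refine le_integral_abs_crossForm hc0 (hI p hp.le) (hI q hq.le) (hI2 p hp.le) (hI2 q hq.le)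
      (by positivity) ?_
    rw [integral_measurementLaw (by fun_prop)]
    simp only [crossForm_ofRealCoords]
    have hlow := mul_sum_sq_le_integral_quadratic_sq (β := β) hmom hmean
      ((min_le_right _ _).trans (by gcongr)) (by
        have : β ≤ κ := min_le_left _ _
        linarith) (crossCoeff p q) (fun i j => by simp only [crossCoeff]; ring)
    refine le_trans ?_ hlow
    have := half_le_sum_crossCoeff_sq hp hq hpq
    nlinarith

end Amplitudes

/-! ### Uniform bounds for the empirical process -/

/-- Chernoff's bound for a sum of independent variables. -/
theorem pi_measureReal_sum_ge_le {X : Type*} [MeasurableSpace X] {μ : Measure X}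
    [IsProbabilityMeasure μ] {n : ℕ} {g : Fin n → X → ℝ} {b : ℝ}
    (hint : ∀ k, Integrable (fun x => Real.exp (g k x)) μ)
    (hle : ∀ k, ∫ x, Real.exp (g k x) ∂μ ≤ Real.exp b) (t : ℝ) :
    (Measure.pi fun _ : Fin n => μ).real {a | t ≤ ∑ k, g k (a k)} ≤ Real.exp (n * b - t) := by
  have hI := Integrable.fintype_prod (μ := fun _ : Fin n => μ)
    (f := fun k x => Real.exp (g k x)) hint
  have h := mul_meas_ge_le_integral_of_nonneg
    (ae_of_all _ fun a => Finset.prod_nonneg fun k _ => (Real.exp_pos _).le) hI (Real.exp t)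
  rw [integral_fintype_prod_eq_prod (𝕜 := ℝ) (μ := fun _ : Fin n => μ)
    (fun k x => Real.exp (g k x))] at h
  simp only [← Real.exp_sum, Real.exp_le_exp] at h
  have h2 : ∏ k, ∫ x, Real.exp (g k x) ∂μ ≤ Real.exp (n * b) := by
    calc ∏ k, ∫ x, Real.exp (g k x) ∂μ ≤ ∏ _k : Fin n, Real.exp b :=
          Finset.prod_le_prod (fun k _ => integral_nonneg fun x => (Real.exp_pos _).le)
            fun k _ => hle k
      _ = _ := by rw [Finset.prod_const, ← Real.exp_nat_mul]; simp
  rw [Real.exp_sub, le_div_iff₀ (Real.exp_pos _), mul_comm]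
  exact h.trans h2

/-- Union bound over a finite set. -/
theorem measureReal_exists_mem_le {X Y : Type*} [MeasurableSpace X] {ν : Measure X}
    [IsFiniteMeasure ν] (N : Finset Y) (B : Y → Set X) {b : ℝ} (h : ∀ y ∈ N, ν.real (B y) ≤ b) :
    ν.real {x | ∃ y ∈ N, x ∈ B y} ≤ N.card * b := by
  have e : {x | ∃ y ∈ N, x ∈ B y} = ⋃ y ∈ N, B y := by ext x; simp
  rw [e]
  refine (measureReal_biUnion_finset_le N B).trans ((Finset.sum_le_sum h).trans ?_)
  simp

section EmpiricalProcess

variable {𝕜 : Type*} [RCLike 𝕜] {d n : ℕ}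

theorem finrank_euclideanSpace_le : Module.finrank ℝ (EuclideanSpace 𝕜 (Fin d)) ≤ 2 * d := by
  have e : Module.finrank ℝ (EuclideanSpace 𝕜 (Fin d)) = Module.finrank ℝ (Fin d → 𝕜) :=
    (WithLp.linearEquiv 2 ℝ (Fin d → 𝕜)).finrank_eq
  rw [e, Module.finrank_pi_fintype]
  simp only [Finset.sum_const, Finset.card_univ, Fintype.card_fin, smul_eq_mul]
  rw [mul_comm]
  exact Nat.mul_le_mul_right _ (RCLike.finrank_le_two 𝕜)

theorem nine_le_exp_three : (9 : ℝ) ≤ Real.exp 3 := by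
  have h1 := Real.add_one_le_exp (3 / 2 : ℝ)
  have h2 : Real.exp 3 = Real.exp (3 / 2) * Real.exp (3 / 2) := by rw [← Real.exp_add]; norm_num
  have h3 := Real.quadratic_le_exp_of_nonneg (x := 3 / 2) (by norm_num)
  rw [h2]
  nlinarith

/-- A `1/4`-net of the unit sphere of `𝕜 ^ d` of cardinality at most `exp (6 d)`. -/
theorem exists_sphere_net (𝕜 : Type*) [RCLike 𝕜] (d : ℕ) :
    ∃ N : Finset (EuclideanSpace 𝕜 (Fin d)), (∀ y ∈ N, ‖y‖ = 1) ∧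
      (N.card : ℝ) ≤ Real.exp (6 * d) ∧
      ∀ x : EuclideanSpace 𝕜 (Fin d), ‖x‖ = 1 → ∃ y ∈ N, ‖x - y‖ ≤ 1 / 4 := by
  obtain ⟨N, h1, h2, h3⟩ := exists_finset_net (E := EuclideanSpace 𝕜 (Fin d)) {x | ‖x‖ = 1}
    (fun x hx => le_of_eq hx) (ε := 1 / 4) (by norm_num)
  refine ⟨N, h1, h2.trans ?_, h3⟩
  calc (1 + 2 / (1 / 4 : ℝ)) ^ Module.finrank ℝ (EuclideanSpace 𝕜 (Fin d))
      ≤ (Real.exp 3) ^ Module.finrank ℝ (EuclideanSpace 𝕜 (Fin d)) := by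
        gcongr; linarith [nine_le_exp_three]
    _ ≤ (Real.exp 3) ^ (2 * d) :=
        pow_le_pow_right₀ (Real.one_le_exp (by norm_num)) finrank_euclideanSpace_le
    _ = Real.exp (6 * d) := by rw [← Real.exp_nat_mul]; congr 1; push_cast; ring

/-- The quadratic form `u ↦ ∑ₖ eₖ |aₖ^* u|²` of weighted intensities, polarized. -/
noncomputable def weightedForm (e : Fin n → ℝ) (a : Fin n → Fin d → 𝕜) :
    LinearMap.BilinForm ℝ (EuclideanSpace 𝕜 (Fin d)) :=
  ∑ k, e k • crossForm (a k)

theorem weightedForm_apply (e : Fin n → ℝ) (a : Fin n → Fin d → 𝕜)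
    (u v : EuclideanSpace 𝕜 (Fin d)) :
    weightedForm e a u v = ∑ k, e k * crossForm (a k) u v := by
  simp [weightedForm, LinearMap.sum_apply]

theorem abs_weightedForm_le_of_net {N : Finset (EuclideanSpace 𝕜 (Fin d))}
    (hN1 : ∀ y ∈ N, ‖y‖ = 1)
    (hN : ∀ x : EuclideanSpace 𝕜 (Fin d), ‖x‖ = 1 → ∃ y ∈ N, ‖x - y‖ ≤ 1 / 4)
    (e : Fin n → ℝ) (a : Fin n → Fin d → 𝕜) {T : ℝ}
    (hT : ∀ y ∈ N, |∑ k, e k * ‖amp (a k) y‖ ^ 2| ≤ T) (u v : EuclideanSpace 𝕜 (Fin d)) :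
    |∑ k, e k * crossForm (a k) u v| ≤ 2 * T * (‖u‖ * ‖v‖) := by
  have h := abs_bilin_le_of_net (Q := weightedForm e a)
    (fun u v => by simp only [weightedForm_apply, crossForm_symm _ u v])
    (B := ∑ k, |e k| * ‖WithLp.toLp 2 (a k)‖ ^ 2) (fun u => ?_) hN1 hN (m := T)
    (fun y hy => by simpa only [weightedForm_apply, crossForm_self] using hT y hy) u v
  · simpa only [weightedForm_apply] using h
  · rw [weightedForm_apply, Finset.sum_mul]
    refine (Finset.abs_sum_le_sum_abs _ _).trans (Finset.sum_le_sum fun k _ => ?_)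
    rw [abs_mul, crossForm_self, abs_of_nonneg (sq_nonneg ‖amp (a k) u‖), mul_assoc, ← mul_pow]
    gcongr
    exact norm_amp_le _ _

variable {μ : Measure (Fin d → 𝕜)} [IsProbabilityMeasure μ] {c s m : ℝ}

/-- The sample covariance is bounded with overwhelming probability. -/
theorem exists_event_sum_norm_amp_sq_le (hc : 0 < c) (h : IsRegularLaw μ c s m) (hdn : d ≤ n) :
    ∃ G : Set (Fin n → Fin d → 𝕜), MeasurableSet G ∧
      (Measure.pi fun _ : Fin n => μ).real Gᶜ ≤ Real.exp (-2 * n) ∧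
      ∀ a ∈ G, ∀ u, ∑ k, ‖amp (a k) u‖ ^ 2 ≤ 18 / c * n * ‖u‖ ^ 2 := by
  obtain ⟨N, hN1, hcard, hN⟩ := exists_sphere_net 𝕜 d
  have hpt : ∀ y ∈ N, (Measure.pi fun _ : Fin n => μ).real
      {a | 9 * (n : ℝ) ≤ ∑ k, c * ‖amp (a k) y‖ ^ 2} ≤ Real.exp (n * 1 - 9 * n) := by
    intro y hy
    refine pi_measureReal_sum_ge_le (g := fun _ a => c * ‖amp a y‖ ^ 2)
      (fun _ => h.integrable_exp y (hN1 y hy).le)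
      (fun _ => (h.integral_exp_le y (hN1 y hy).le).trans ?_) _
    linarith [Real.add_one_le_exp (1 : ℝ)]
  refine ⟨{a | ∃ y ∈ N, 9 * (n : ℝ) ≤ ∑ k, c * ‖amp (a k) y‖ ^ 2}ᶜ, ?_, ?_, ?_⟩
  · have e : {a : Fin n → Fin d → 𝕜 | ∃ y ∈ N, 9 * (n : ℝ) ≤ ∑ k, c * ‖amp (a k) y‖ ^ 2} =
        ⋃ y ∈ N, {a | 9 * (n : ℝ) ≤ ∑ k, c * ‖amp (a k) y‖ ^ 2} := by ext; simp
    rw [e]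
    refine (Finset.measurableSet_biUnion _ fun y _ => measurableSet_le (by fun_prop) ?_).compl
    exact Finset.measurable_sum _ fun k _ =>
      (((measurable_amp y).comp (measurable_pi_apply k)).norm.pow_const 2).const_mul c
  · rw [compl_compl]
    refine (measureReal_exists_mem_le N _ hpt).trans ?_
    calc (N.card : ℝ) * Real.exp (n * 1 - 9 * n)
        ≤ Real.exp (6 * d) * Real.exp (n * 1 - 9 * n) := by gcongr
      _ ≤ Real.exp (-2 * n) := by
        rw [← Real.exp_add]
        refine Real.exp_le_exp.2 ?_
        have : (d : ℝ) ≤ n := by exact_mod_cast hdn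
        linarith
  · intro a ha u
    have h1 : ∀ y ∈ N, |∑ k, (1 : ℝ) * ‖amp (a k) y‖ ^ 2| ≤ 9 / c * n := by
      intro y hy
      have : ¬ 9 * (n : ℝ) ≤ ∑ k, c * ‖amp (a k) y‖ ^ 2 := fun hcon => ha ⟨y, hy, hcon⟩
      rw [← Finset.mul_sum, not_le] at this
      simp only [one_mul]
      rw [abs_of_nonneg (Finset.sum_nonneg fun k _ => sq_nonneg _), div_mul_eq_mul_div,
        le_div_iff₀ hc, mul_comm]
      exact this.le
    have h2 := (le_abs_self _).trans (abs_weightedForm_le_of_net hN1 hN (fun _ => 1) a h1 u u)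
    simp only [one_mul, crossForm_self] at h2
    refine h2.trans (le_of_eq ?_)
    ring

/-- Lower tail of a sum of nonnegative variables with controlled first two moments. -/
theorem measureReal_sum_abs_crossForm_le (hc : 0 < c) (hm : 0 < m) (h : IsRegularLaw μ c s m)
    {p q : EuclideanSpace 𝕜 (Fin d)} (hp : ‖p‖ = 1) (hq : ‖q‖ = 1)
    (hpq : RCLike.im (inner 𝕜 p q) = 0) :
    (Measure.pi fun _ : Fin n => μ).real {a | ∑ k, |crossForm (a k) p q| ≤ m / 2 * n} ≤
      Real.exp (-(m ^ 2 * c ^ 2 / 64) * n) := by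
  have hip := h.integrable_exp p hp.le
  have hiq := h.integrable_exp q hq.le
  have hi := integrable_abs_crossForm_pow hc hip hiq
  have h2 := integral_abs_crossForm_pow_le hc hip hiq (h.integral_exp_le p hp.le)
    (h.integral_exp_le q hq.le) 2
  have h1 := h.le_integral_abs p q hp hq hpq
  have hi1 : Integrable (fun a => |crossForm a p q|) μ := by simpa using hi 1
  -- The exponent minimizing the resulting bound, up to a constant: `4 / c ^ 2` bounds the second moment.
  set l := m * c ^ 2 / 16 with hl
  have hl0 : 0 < l := by positivity
  have hexp : ∀ a : Fin d → 𝕜, Real.exp (-l * |crossForm a p q|) ≤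
      1 - l * |crossForm a p q| + l ^ 2 * |crossForm a p q| ^ 2 := by
    intro a
    have := exp_neg_le_one_sub_add_sq (y := l * |crossForm a p q|) (by positivity)
    rw [mul_pow] at this
    rwa [neg_mul]
  have hI2 : Integrable (fun a => 1 - l * |crossForm a p q|) μ :=
    (integrable_const _).sub (hi1.const_mul l)
  have hI : Integrable (fun a => Real.exp (-l * |crossForm a p q|)) μ := by
    refine Integrable.mono' (integrable_const (1 : ℝ))
      (((measurable_crossForm p q).abs.const_mul _).exp.aestronglyMeasurable)
      (ae_of_all _ fun a => ?_)
    rw [Real.norm_eq_abs, Real.abs_exp]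
    exact Real.exp_le_one_iff.2 (by nlinarith [abs_nonneg (crossForm a p q)])
  have hle : ∫ a, Real.exp (-l * |crossForm a p q|) ∂μ ≤
      Real.exp (-l * m + l ^ 2 * (4 / c ^ 2)) := by
    calc ∫ a, Real.exp (-l * |crossForm a p q|) ∂μ
        ≤ ∫ a, (1 - l * |crossForm a p q| + l ^ 2 * |crossForm a p q| ^ 2) ∂μ :=
          integral_mono hI (hI2.add ((hi 2).const_mul _)) hexp
      _ = 1 - l * ∫ a, |crossForm a p q| ∂μ + l ^ 2 * ∫ a, |crossForm a p q| ^ 2 ∂μ := by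
          rw [integral_add hI2 ((hi 2).const_mul _), integral_sub (integrable_const _)
            (hi1.const_mul l), integral_const_mul, integral_const_mul]
          simp
      _ ≤ 1 - l * m + l ^ 2 * (4 / c ^ 2) := by
          have e : (2 * (2 : ℕ).factorial / c ^ 2 : ℝ) = 4 / c ^ 2 := by norm_num [Nat.factorial]
          rw [e] at h2
          gcongr
      _ ≤ _ := by
          have := Real.add_one_le_exp (-l * m + l ^ 2 * (4 / c ^ 2))
          linarith
  have := pi_measureReal_sum_ge_le (n := n) (g := fun _ a => -l * |crossForm a p q|)
    (fun _ => hI) (fun _ => hle) (-l * (m / 2 * n))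
  have e : {a : Fin n → Fin d → 𝕜 | -l * (m / 2 * n) ≤ ∑ k, -l * |crossForm (a k) p q|} =
      {a | ∑ k, |crossForm (a k) p q| ≤ m / 2 * n} := by
    ext a
    simp only [Set.mem_ofPred_eq, ← Finset.mul_sum]
    rw [neg_mul, neg_mul, neg_le_neg_iff, mul_le_mul_iff_right₀ hl0]
  rw [e] at this
  refine this.trans (le_of_eq ?_)
  congr 1
  rw [hl]
  field_simp
  ring

/-- The restricted lower bound that makes the risk coercive along rank-two directions, in `ℓ₁` form:
the crossed amplitudes are averaged in absolute value, which makes the passage from a net to all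
directions a consequence of the bound on the sample covariance. -/
def HasLowerBound (a : Fin n → Fin d → 𝕜) (l : ℝ) : Prop :=
  ∀ p q : EuclideanSpace 𝕜 (Fin d), RCLike.im (inner 𝕜 p q) = 0 →
    l * n * (‖p‖ * ‖q‖) ≤ ∑ k, |crossForm (a k) p q|

/-- The radius `m * c / 144` of the net is chosen such that each of the two approximation errors, which
the sample covariance bound controls by `18 / c * n` times the distance, is at most `m / 8 * n`. -/
theorem hasLowerBound_of_net (hc : 0 < c) (hm : 0 < m) {a : Fin n → Fin d → 𝕜}
    (hup : ∀ u, ∑ k, ‖amp (a k) u‖ ^ 2 ≤ 18 / c * n * ‖u‖ ^ 2)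
    {N : Finset (EuclideanSpace 𝕜 (Fin d) × EuclideanSpace 𝕜 (Fin d))}
    (hN1 : ∀ y ∈ N, ‖y.1‖ = 1 ∧ ‖y.2‖ = 1)
    (hN : ∀ p q : EuclideanSpace 𝕜 (Fin d), ‖p‖ = 1 → ‖q‖ = 1 → RCLike.im (inner 𝕜 p q) = 0 →
      ∃ y ∈ N, ‖(p, q) - y‖ ≤ m * c / 144)
    (hlow : ∀ y ∈ N, m / 2 * n ≤ ∑ k, |crossForm (a k) y.1 y.2|) :
    HasLowerBound a (m / 4) := by
  have hcs : ∀ u v : EuclideanSpace 𝕜 (Fin d), ∑ k, ‖amp (a k) u‖ * ‖amp (a k) v‖ ≤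
      18 / c * n * (‖u‖ * ‖v‖) := by
    intro u v
    have h1 := Finset.sum_mul_sq_le_sq_mul_sq Finset.univ (fun k => ‖amp (a k) u‖)
      (fun k => ‖amp (a k) v‖)
    refine abs_le_of_sq_le_sq' (h1.trans ?_) (by positivity) |>.2
    calc _ ≤ (18 / c * n * ‖u‖ ^ 2) * (18 / c * n * ‖v‖ ^ 2) :=
          mul_le_mul (hup u) (hup v) (Finset.sum_nonneg fun _ _ => sq_nonneg _) (by positivity)
      _ = _ := by ring
  have unit_case : ∀ p q : EuclideanSpace 𝕜 (Fin d), ‖p‖ = 1 → ‖q‖ = 1 →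
      RCLike.im (inner 𝕜 p q) = 0 → m / 4 * n ≤ ∑ k, |crossForm (a k) p q| := by
    intro p q hp hq hpq
    obtain ⟨⟨p', q'⟩, hy, hdist⟩ := hN p q hp hq hpq
    obtain ⟨hp', hq'⟩ := hN1 _ hy
    have hd1 : ‖p - p'‖ ≤ m * c / 144 := (norm_fst_le ((p, q) - (p', q'))).trans hdist
    have hd2 : ‖q - q'‖ ≤ m * c / 144 := (norm_snd_le ((p, q) - (p', q'))).trans hdist
    have hk : ∀ k, |crossForm (a k) p' q'| ≤ |crossForm (a k) p q| +
        (‖amp (a k) (p - p')‖ * ‖amp (a k) q‖ + ‖amp (a k) p'‖ * ‖amp (a k) (q - q')‖) := by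
      intro k
      have e : crossForm (a k) p' q' = crossForm (a k) p q -
          (crossForm (a k) (p - p') q + crossForm (a k) p' (q - q')) := by
        simp only [map_sub, LinearMap.sub_apply]; ring
      rw [e]
      refine (abs_sub _ _).trans (add_le_add le_rfl ((abs_add_le _ _).trans ?_))
      exact add_le_add (abs_crossForm_le _ _ _) (abs_crossForm_le _ _ _)
    have hsum := Finset.sum_le_sum fun k (_ : k ∈ Finset.univ) => hk k
    rw [Finset.sum_add_distrib, Finset.sum_add_distrib] at hsum
    have h1 := hcs (p - p') q
    have h2 := hcs p' (q - q')
    have h3 := hlow _ hy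
    rw [hq, mul_one] at h1
    rw [hp', one_mul] at h2
    simp only at hp' hq' h3
    have h4 : 18 / c * n * ‖p - p'‖ ≤ m / 8 * n := by
      calc 18 / c * n * ‖p - p'‖ ≤ 18 / c * n * (m * c / 144) := by gcongr
        _ = m / 8 * n := by field_simp; ring
    have h5 : 18 / c * n * ‖q - q'‖ ≤ m / 8 * n := by
      calc 18 / c * n * ‖q - q'‖ ≤ 18 / c * n * (m * c / 144) := by gcongr
        _ = m / 8 * n := by field_simp; ring
    linarith
  intro p q hpq
  rcases eq_or_ne p 0 with rfl | hp
  · simp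
  rcases eq_or_ne q 0 with rfl | hq
  · simp
  have hp' : 0 < ‖p‖ := norm_pos_iff.2 hp
  have hq' : 0 < ‖q‖ := norm_pos_iff.2 hq
  have h := unit_case (‖p‖⁻¹ • p) (‖q‖⁻¹ • q) (by rw [norm_smul]; simp [hp'.ne'])
    (by rw [norm_smul]; simp [hq'.ne']) (by
      rw [RCLike.real_smul_eq_coe_smul (K := 𝕜) ‖p‖⁻¹ p, RCLike.real_smul_eq_coe_smul (K := 𝕜) ‖q‖⁻¹ q,
        inner_smul_left, inner_smul_right, RCLike.conj_ofReal, RCLike.im_ofReal_mul,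
        RCLike.im_ofReal_mul, hpq, mul_zero, mul_zero])
  simp only [map_smul, LinearMap.smul_apply, smul_eq_mul, abs_mul, abs_inv, abs_norm,
    ← Finset.mul_sum] at h
  rw [le_inv_mul_iff₀ hq', le_inv_mul_iff₀ hp'] at h
  linarith

/-- The lower bound holds uniformly with overwhelming probability once `n` is a large multiple of
`d`. -/
theorem exists_event_hasLowerBound (hc : 0 < c) (hm : 0 < m) (h : IsRegularLaw μ c s m)
    (hdn : d ≤ n)
    (hdn' : 4 * Real.log (1 + 2 / (m * c / 144)) * d ≤ m ^ 2 * c ^ 2 / 128 * n) :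
    ∃ G : Set (Fin n → Fin d → 𝕜), MeasurableSet G ∧
      (Measure.pi fun _ : Fin n => μ).real Gᶜ ≤
        Real.exp (-2 * n) + Real.exp (-(m ^ 2 * c ^ 2 / 128) * n) ∧
      ∀ a ∈ G, HasLowerBound a (m / 4) := by
  obtain ⟨G₁, hG₁, hG₁', hup⟩ := exists_event_sum_norm_amp_sq_le hc h hdn
  have hε : 0 < m * c / 144 := by positivity
  obtain ⟨N, hNS, hcard, hN⟩ := exists_finset_net
    (E := EuclideanSpace 𝕜 (Fin d) × EuclideanSpace 𝕜 (Fin d))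
    {y | ‖y.1‖ = 1 ∧ ‖y.2‖ = 1 ∧ RCLike.im (inner 𝕜 y.1 y.2) = 0}
    (fun y hy => by rw [Prod.norm_def, hy.1, hy.2.1, max_self]) hε
  have hfr : Module.finrank ℝ (EuclideanSpace 𝕜 (Fin d) × EuclideanSpace 𝕜 (Fin d)) ≤ 4 * d := by
    rw [Module.finrank_prod]
    have := finrank_euclideanSpace_le (𝕜 := 𝕜) (d := d)
    omega
  have hL : 0 < 2 / (m * c / 144) := by positivity
  have hcard' : (N.card : ℝ) ≤ Real.exp (4 * Real.log (1 + 2 / (m * c / 144)) * d) := by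
    refine (hcard.trans (pow_le_pow_right₀ (by linarith) hfr)).trans (le_of_eq ?_)
    rw [← Real.exp_log (show 0 < 1 + 2 / (m * c / 144) by linarith), ← Real.exp_nat_mul,
      Real.log_exp]
    congr 1; push_cast; ring
  let B : EuclideanSpace 𝕜 (Fin d) × EuclideanSpace 𝕜 (Fin d) → Set (Fin n → Fin d → 𝕜) :=
    fun y => {a | ∑ k, |crossForm (a k) y.1 y.2| ≤ m / 2 * n}
  have hB : ∀ y, MeasurableSet (B y) := fun y =>
    measurableSet_le (Finset.measurable_sum _ fun k _ =>
      ((measurable_crossForm y.1 y.2).comp (measurable_pi_apply k)).abs) measurable_const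
  have hbad := measureReal_exists_mem_le (ν := Measure.pi fun _ : Fin n => μ) N B
    (fun y hy => measureReal_sum_abs_crossForm_le hc hm h (hNS y hy).1 (hNS y hy).2.1
      (hNS y hy).2.2)
  have hmeas : MeasurableSet {a | ∃ y ∈ N, a ∈ B y} := by
    have e : {a | ∃ y ∈ N, a ∈ B y} = ⋃ y ∈ N, B y := by ext; simp
    rw [e]
    exact Finset.measurableSet_biUnion _ fun y _ => hB y
  refine ⟨G₁ ∩ {a | ∃ y ∈ N, a ∈ B y}ᶜ, hG₁.inter hmeas.compl, ?_, ?_⟩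
  · rw [Set.compl_inter, compl_compl]
    refine (measureReal_union_le _ _).trans (add_le_add hG₁' (hbad.trans ?_))
    calc (N.card : ℝ) * Real.exp (-(m ^ 2 * c ^ 2 / 64) * n)
        ≤ Real.exp (4 * Real.log (1 + 2 / (m * c / 144)) * d) *
          Real.exp (-(m ^ 2 * c ^ 2 / 64) * n) := by gcongr
      _ ≤ _ := by
        rw [← Real.exp_add]
        refine Real.exp_le_exp.2 ?_
        linarith
  · rintro a ⟨ha1, ha2⟩
    refine hasLowerBound_of_net hc hm (hup a ha1) (fun y hy => ⟨(hNS y hy).1, (hNS y hy).2.1⟩)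
      (fun p q hp hq hpq => hN (p, q) ⟨hp, hq, hpq⟩) fun y hy => ?_
    by_contra hcon
    exact ha2 ⟨y, hy, (not_le.1 hcon).le⟩

/-- Bernstein's inequality for the weighted sums of centred intensities, in the sub-Gaussian range. -/
theorem measureReal_weighted_sum_le (hc : 0 < c) (h : IsRegularLaw μ c s m) (hd : 0 < d)
    (hdn : d ≤ n) {e : Fin n → ℝ} (he : 0 < ‖e‖) {u : EuclideanSpace 𝕜 (Fin d)} (hu : ‖u‖ = 1) :
    (Measure.pi fun _ : Fin n => μ).real
      {a | 82 / c * ‖e‖ * √(d * n) ≤ ∑ k, e k * (‖amp (a k) u‖ ^ 2 - s)} ≤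
      Real.exp (-9 * d) := by
  have hint := h.integrable_exp u hu.le
  have h2 := h.integral_exp_le u hu.le
  have hsq := h.integral_sq u
  rw [hu, one_pow, mul_one] at hsq
  have hisq : Integrable (fun a => ‖amp a u‖ ^ 2) μ := by
    simpa using integrable_norm_amp_pow hc hint 1
  have hs0 : 0 ≤ s := hsq ▸ integral_nonneg fun a => sq_nonneg _
  have hs2 : c * s ≤ 2 := by
    have := integral_norm_amp_pow_le hc hint h2 1
    simp only [mul_one, hsq, Nat.factorial_one, Nat.cast_one, pow_one] at this
    rwa [le_div_iff₀ hc, mul_comm] at this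
  have hd' : (0 : ℝ) < d := by exact_mod_cast hd
  have hdn' : (d : ℝ) ≤ n := by exact_mod_cast hdn
  have hn' : (0 : ℝ) < n := hd'.trans_le hdn'
  have hexp2 : Real.exp 2 ≤ 8 := by
    have h1 := Real.exp_one_lt_d9
    have h3 : Real.exp 2 = Real.exp 1 * Real.exp 1 := by rw [← Real.exp_add]; norm_num
    rw [h3]
    nlinarith [Real.exp_pos 1]
  -- As `d ≤ n`, this exponent stays below `c / 2`, where the exponential moments are controlled.
  set θ := c / 2 * √(d / n) with hθ
  have hθ0 : 0 < θ := by positivity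
  have hθc : θ ≤ c / 2 := by
    have : √((d : ℝ) / n) ≤ 1 := Real.sqrt_le_one.2 ((div_le_one hn').2 hdn')
    nlinarith
  have hθ2 : θ ^ 2 = c ^ 2 / 4 * (d / n) := by
    rw [hθ, mul_pow, Real.sq_sqrt (by positivity)]; ring
  have hw : ∀ k, |e k / ‖e‖| ≤ 1 := by
    intro k
    rw [abs_div, abs_norm, div_le_one he]
    exact norm_le_pi_norm e k
  have hpt : ∀ (w : ℝ), |w| ≤ 1 → ∀ a : Fin d → 𝕜,
      Real.exp (θ * w * (‖amp a u‖ ^ 2 - s)) ≤ 1 + θ * w * (‖amp a u‖ ^ 2 - s) +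
        θ ^ 2 * (64 / c ^ 2) * Real.exp (c * ‖amp a u‖ ^ 2) := by
    intro w hw a
    set z := ‖amp a u‖ ^ 2 - s with hz
    refine (exp_le_one_add_add_sq_mul_exp_abs _).trans (add_le_add le_rfl ?_)
    have hzabs : |z| ≤ ‖amp a u‖ ^ 2 + s := by
      rw [abs_le]; constructor <;> nlinarith [sq_nonneg ‖amp a u‖]
    have h1 : |θ * w * z| ≤ c / 2 * |z| := by
      rw [abs_mul, abs_mul, abs_of_pos hθ0]
      gcongr
      nlinarith [abs_nonneg w]
    have h3 : (θ * w * z) ^ 2 ≤ θ ^ 2 * |z| ^ 2 := by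
      rw [mul_pow, mul_pow, sq_abs]
      have : w ^ 2 ≤ 1 := by rw [← sq_abs]; exact pow_le_one₀ (abs_nonneg _) hw
      have hz2 : 0 ≤ θ ^ 2 * z ^ 2 := by positivity
      nlinarith
    have h4 : |z| ^ 2 ≤ 8 / c ^ 2 * Real.exp (c / 2 * |z|) := by
      have := pow_le_factorial_mul_exp (x := c / 2 * |z|) (by positivity) 2
      rw [mul_pow, Nat.factorial_two] at this
      push_cast at this
      rw [div_mul_eq_mul_div, le_div_iff₀ (by positivity)]
      linarith
    calc (θ * w * z) ^ 2 * Real.exp |θ * w * z|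
        ≤ (θ ^ 2 * (8 / c ^ 2 * Real.exp (c / 2 * |z|))) * Real.exp (c / 2 * |z|) := by
          refine mul_le_mul (h3.trans (by gcongr)) (Real.exp_le_exp.2 h1) (Real.exp_pos _).le
            (by positivity)
      _ = θ ^ 2 * (8 / c ^ 2) * Real.exp (c * |z|) := by
          have : Real.exp (c * |z|) = Real.exp (c / 2 * |z|) * Real.exp (c / 2 * |z|) := by
            rw [← Real.exp_add]; ring_nf
          rw [this]; ring
      _ ≤ θ ^ 2 * (8 / c ^ 2) * (8 * Real.exp (c * ‖amp a u‖ ^ 2)) := by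
          gcongr
          calc Real.exp (c * |z|) ≤ Real.exp (2 + c * ‖amp a u‖ ^ 2) :=
                Real.exp_le_exp.2 (by nlinarith)
            _ = Real.exp 2 * Real.exp (c * ‖amp a u‖ ^ 2) := Real.exp_add _ _
            _ ≤ _ := by gcongr
      _ = _ := by ring
  have hmono : ∀ (w : ℝ), |w| ≤ 1 → Integrable (fun a => 1 + θ * w * (‖amp a u‖ ^ 2 - s) +
        θ ^ 2 * (64 / c ^ 2) * Real.exp (c * ‖amp a u‖ ^ 2)) μ := fun w _ =>
    (((integrable_const _).add ((hisq.sub (integrable_const _)).const_mul _)).add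
      (hint.const_mul _))
  have hI : ∀ (w : ℝ), |w| ≤ 1 →
      Integrable (fun a => Real.exp (θ * w * (‖amp a u‖ ^ 2 - s))) μ := by
    intro w hw
    refine Integrable.mono' (hmono w hw) (by fun_prop) (ae_of_all _ fun a => ?_)
    rw [Real.norm_eq_abs, Real.abs_exp]
    exact hpt w hw a
  have hle : ∀ (w : ℝ), |w| ≤ 1 → ∫ a, Real.exp (θ * w * (‖amp a u‖ ^ 2 - s)) ∂μ ≤
      Real.exp (θ ^ 2 * (128 / c ^ 2)) := by
    intro w hw
    have hc1 : Integrable (fun a => ‖amp a u‖ ^ 2 - s) μ := hisq.sub (integrable_const _)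
    calc ∫ a, Real.exp (θ * w * (‖amp a u‖ ^ 2 - s)) ∂μ
        ≤ ∫ a, (1 + θ * w * (‖amp a u‖ ^ 2 - s) +
          θ ^ 2 * (64 / c ^ 2) * Real.exp (c * ‖amp a u‖ ^ 2)) ∂μ :=
          integral_mono (hI w hw) (hmono w hw) (hpt w hw)
      _ = 1 + θ ^ 2 * (64 / c ^ 2) * ∫ a, Real.exp (c * ‖amp a u‖ ^ 2) ∂μ := by
          have hc2 : Integrable (fun a => 1 + θ * w * (‖amp a u‖ ^ 2 - s)) μ :=
            (integrable_const _).add (hc1.const_mul _)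
          rw [integral_add hc2 (hint.const_mul _),
            integral_add (integrable_const _) (hc1.const_mul _), integral_const_mul,
            integral_const_mul, integral_sub hisq (integrable_const _), hsq]
          simp
      _ ≤ 1 + θ ^ 2 * (64 / c ^ 2) * 2 := by gcongr
      _ ≤ _ := by
          have := Real.add_one_le_exp (θ ^ 2 * (128 / c ^ 2))
          have e : θ ^ 2 * (64 / c ^ 2) * 2 = θ ^ 2 * (128 / c ^ 2) := by ring
          linarith
  have key := pi_measureReal_sum_ge_le (n := n)
    (g := fun k a => θ * (e k / ‖e‖) * (‖amp a u‖ ^ 2 - s))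
    (fun k => hI _ (hw k)) (fun k => hle _ (hw k)) (θ * (82 / c * √(d * n)))
  have es : {a : Fin n → Fin d → 𝕜 | θ * (82 / c * √(d * n)) ≤
      ∑ k, θ * (e k / ‖e‖) * (‖amp (a k) u‖ ^ 2 - s)} =
      {a | 82 / c * ‖e‖ * √(d * n) ≤ ∑ k, e k * (‖amp (a k) u‖ ^ 2 - s)} := by
    ext a
    have e1 : ∑ k, θ * (e k / ‖e‖) * (‖amp (a k) u‖ ^ 2 - s) =
        θ / ‖e‖ * ∑ k, e k * (‖amp (a k) u‖ ^ 2 - s) := by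
      rw [Finset.mul_sum]
      exact Finset.sum_congr rfl fun k _ => by ring
    have e2 : θ * (82 / c * √(d * n)) = θ / ‖e‖ * (82 / c * ‖e‖ * √(d * n)) := by
      field_simp
    simp only [Set.mem_ofPred_eq, e1, e2]
    exact mul_le_mul_iff_right₀ (by positivity)
  rw [es] at key
  refine key.trans (Real.exp_le_exp.2 (le_of_eq ?_))
  have e3 : √((d : ℝ) / n) * √(d * n) = d := by
    rw [← Real.sqrt_mul (by positivity)]
    have : (d : ℝ) / n * (d * n) = d ^ 2 := by field_simp
    rw [this, Real.sqrt_sq hd'.le]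
  have e4 : θ * (82 / c * √(d * n)) = 41 * d := by
    calc θ * (82 / c * √(d * n)) = 41 * (√((d : ℝ) / n) * √(d * n)) := by
          rw [hθ]; field_simp; ring
      _ = 41 * d := by rw [e3]
  rw [e4, hθ2]
  field_simp
  ring

/-- For every fixed noise vector, the weighted form is bounded with high probability; the event is
jointly measurable in the noise and the measurement vectors. -/
theorem exists_event_abs_weighted_sum_le (hc : 0 < c) (h : IsRegularLaw μ c s m) (hd : 0 < d)
    (hdn : d ≤ n) :
    ∃ G : Set ((Fin n → ℝ) × (Fin n → Fin d → 𝕜)), MeasurableSet G ∧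
      (∀ e, (Measure.pi fun _ : Fin n => μ).real {a | (e, a) ∉ G} ≤ 2 * Real.exp (-3 * d)) ∧
      ∀ e a, (e, a) ∈ G → ∀ p q, |∑ k, e k * crossForm (a k) p q| ≤
        164 / c * (‖e‖ * √(d * n) + |∑ k, e k|) * (‖p‖ * ‖q‖) := by
  obtain ⟨N, hN1, hcard, hN⟩ := exists_sphere_net 𝕜 d
  let Z : EuclideanSpace 𝕜 (Fin d) → (Fin n → ℝ) → (Fin n → Fin d → 𝕜) → ℝ :=
    fun y e a => ∑ k, e k * (‖amp (a k) y‖ ^ 2 - s)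
  have hZneg : ∀ y e a, Z y (-e) a = -Z y e a := fun y e a => by
    simp [Z, Finset.sum_neg_distrib]
  have hZm : ∀ y, Measurable fun x : (Fin n → ℝ) × (Fin n → Fin d → 𝕜) => Z y x.1 x.2 := by
    intro y
    refine Finset.measurable_sum _ fun k _ => ?_
    have h1 : Measurable fun x : (Fin n → ℝ) × (Fin n → Fin d → 𝕜) => ‖amp (x.2 k) y‖ :=
      ((measurable_amp y).comp ((measurable_pi_apply k).comp measurable_snd)).norm
    fun_prop
  have hG : {x : (Fin n → ℝ) × (Fin n → Fin d → 𝕜) | ∀ y ∈ N,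
      |Z y x.1 x.2| ≤ 82 / c * ‖x.1‖ * √(d * n)} =
      ⋂ y ∈ N, {x | |Z y x.1 x.2| ≤ 82 / c * ‖x.1‖ * √(d * n)} := by ext; simp
  refine ⟨{x | ∀ y ∈ N, |Z y x.1 x.2| ≤ 82 / c * ‖x.1‖ * √(d * n)}, ?_, ?_, ?_⟩
  · rw [hG]
    exact Finset.measurableSet_biInter _ fun y _ =>
      measurableSet_le (hZm y).abs (by fun_prop)
  · intro e
    rcases eq_or_ne e 0 with rfl | he
    · have : {a : Fin n → Fin d → 𝕜 | ((0 : Fin n → ℝ), a) ∉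
          {x : (Fin n → ℝ) × (Fin n → Fin d → 𝕜) | ∀ y ∈ N,
            |Z y x.1 x.2| ≤ 82 / c * ‖x.1‖ * √(d * n)}} = ∅ := by
        ext a; simp [Z]
      rw [this, measureReal_empty]
      positivity
    have he0 : 0 < ‖e‖ := norm_pos_iff.2 he
    have hpt : ∀ y ∈ N, (Measure.pi fun _ : Fin n => μ).real
        ({a | 82 / c * ‖e‖ * √(d * n) ≤ Z y e a} ∪ {a | 82 / c * ‖e‖ * √(d * n) ≤ Z y (-e) a}) ≤
        2 * Real.exp (-9 * d) := by
      intro y hy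
      have h1 := measureReal_weighted_sum_le hc h hd hdn he0 (hN1 y hy)
      have h2 := measureReal_weighted_sum_le hc h hd hdn (e := -e) (by rwa [norm_neg]) (hN1 y hy)
      rw [norm_neg] at h2
      refine (measureReal_union_le _ _).trans ?_
      rw [two_mul]
      exact add_le_add h1 h2
    have hbad := measureReal_exists_mem_le N _ hpt
    refine (measureReal_mono ?_ (measure_ne_top _ _)).trans (hbad.trans ?_)
    · intro a ha
      simp only [Set.mem_ofPred_eq, not_forall, not_le] at ha
      obtain ⟨y, hy, hya⟩ := ha
      refine ⟨y, hy, ?_⟩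
      rcases lt_abs.1 hya with h1 | h1
      · exact Or.inl h1.le
      · refine Or.inr ?_
        rw [Set.mem_ofPred_eq, hZneg]
        exact h1.le
    · calc (N.card : ℝ) * (2 * Real.exp (-9 * d)) ≤ Real.exp (6 * d) * (2 * Real.exp (-9 * d)) := by
            gcongr
        _ = 2 * Real.exp (-3 * d) := by
            rw [mul_left_comm, ← Real.exp_add]; ring_nf
  · intro e a hea p q
    have hT : ∀ y ∈ N, |∑ k, e k * ‖amp (a k) y‖ ^ 2| ≤
        82 / c * (‖e‖ * √(d * n) + |∑ k, e k|) := by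
      intro y hy
      have hint := h.integrable_exp y (hN1 y hy).le
      have hsq := h.integral_sq y
      rw [hN1 y hy, one_pow, mul_one] at hsq
      have hs0 : 0 ≤ s := hsq ▸ integral_nonneg fun a => sq_nonneg _
      have hs2 : s ≤ 82 / c := by
        have := integral_norm_amp_pow_le hc hint (h.integral_exp_le y (hN1 y hy).le) 1
        simp only [mul_one, hsq, Nat.factorial_one, Nat.cast_one, pow_one] at this
        exact this.trans (by gcongr; norm_num)
      have e1 : ∑ k, e k * ‖amp (a k) y‖ ^ 2 = Z y e a + s * ∑ k, e k := by
        simp only [Z, Finset.mul_sum, ← Finset.sum_add_distrib]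
        exact Finset.sum_congr rfl fun k _ => by ring
      rw [e1]
      refine (abs_add_le _ _).trans ?_
      rw [abs_mul, abs_of_nonneg hs0]
      have h3 : |Z y e a| ≤ 82 / c * ‖e‖ * √(d * n) := hea y hy
      have h4 : s * |∑ k, e k| ≤ 82 / c * |∑ k, e k| := by gcongr
      linarith
    refine (abs_weightedForm_le_of_net hN1 hN e a hT p q).trans (le_of_eq ?_)
    ring

end EmpiricalProcess

/-! ### From minimizers to error bounds -/

section Deterministic

variable {𝕜 : Type*} [RCLike 𝕜] {d n : ℕ}

theorem frobenius_norm_vecMulVec_le (x y : Fin d → 𝕜) :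
    ‖Matrix.vecMulVec x (star y)‖ ≤ ‖WithLp.toLp 2 x‖ * ‖WithLp.toLp 2 y‖ := by
  rw [Matrix.vecMulVec_eq Unit]
  refine (Matrix.frobenius_norm_mul _ _).trans (le_of_eq ?_)
  rw [Matrix.frobenius_norm_replicateCol, Matrix.frobenius_norm_replicateRow]
  congr 1
  simp [EuclideanSpace.norm_eq]

/-- The factorization `x x^* - z z^* = (p q^* + q p^*) / 2` with `p = x - z` and `q = x + z`. -/
theorem liftedDist_le (x z : EuclideanSpace 𝕜 (Fin d)) :
    liftedDist x.ofLp z.ofLp ≤ ‖x - z‖ * ‖x + z‖ := by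
  -- The factor `1 / 2` is absorbed into `p`.
  set p := (2⁻¹ : 𝕜) • (x - z) with hp
  have hpn : ‖p‖ = 2⁻¹ * ‖x - z‖ := by rw [hp, norm_smul]; simp
  have e : Matrix.vecMulVec x.ofLp (star x.ofLp) - Matrix.vecMulVec z.ofLp (star z.ofLp) =
      Matrix.vecMulVec p.ofLp (star (x + z).ofLp) + Matrix.vecMulVec (x + z).ofLp (star p.ofLp) := by
    ext i j
    simp [Matrix.vecMulVec_apply, hp]
    ring
  rw [liftedDist, e]
  refine (norm_add_le _ _).trans ((add_le_add (frobenius_norm_vecMulVec_le _ _)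
    (frobenius_norm_vecMulVec_le _ _)).trans (le_of_eq ?_))
  simp only [WithLp.toLp_ofLp, hpn]
  ring

/-- A minimizer of the risk produces a pair `p`, `q` with real inner product that controls the error
and satisfies the basic inequality. The global phase of the minimizer is free, and it is chosen such
that its inner product with the signal is real. -/
theorem IsERM.exists_pair {a : Fin n → Fin d → 𝕜} {e : Fin n → ℝ} {x₀ xhat : Fin d → 𝕜}
    (h : IsERM a e x₀ xhat) : ∃ p q : EuclideanSpace 𝕜 (Fin d), RCLike.im (inner 𝕜 p q) = 0 ∧
      liftedDist xhat x₀ ≤ ‖p‖ * ‖q‖ ∧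
      ∑ k, crossForm (a k) p q ^ 2 ≤ 2 * ∑ k, e k * crossForm (a k) p q := by
  set z : EuclideanSpace 𝕜 (Fin d) := WithLp.toLp 2 x₀ with hz
  obtain ⟨c, hc, hcw⟩ := RCLike.exists_norm_eq_mul_self (inner 𝕜 z (WithLp.toLp 2 xhat))
  set x : EuclideanSpace 𝕜 (Fin d) := c • WithLp.toLp 2 xhat with hx
  have hzx : RCLike.im (inner 𝕜 z x) = 0 := by
    rw [hx, inner_smul_right, ← hcw, RCLike.ofReal_im]
  have hxz : RCLike.im (inner 𝕜 x z) = 0 := by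
    rw [← inner_conj_symm, RCLike.conj_im, hzx, neg_zero]
  have hcc : c * star c = 1 := by
    have := RCLike.mul_conj c
    rw [hc] at this
    simpa using this
  have hint : ∀ k, crossForm (a k) (x - z) (x + z) = intensity (a k) xhat - intensity (a k) x₀ := by
    intro k
    have h1 : intensity (a k) xhat = ‖amp (a k) x‖ ^ 2 := by
      rw [intensity, amp_apply, hx]
      simp [dotProduct_smul, hc]
    have h2 : intensity (a k) x₀ = ‖amp (a k) z‖ ^ 2 := rfl
    rw [h1, h2, ← crossForm_self, ← crossForm_self]
    simp only [map_add, map_sub, LinearMap.sub_apply]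
    rw [crossForm_symm _ z x]
    ring
  refine ⟨x - z, x + z, ?_, ?_, ?_⟩
  · rw [inner_sub_left, inner_add_right, inner_add_right]
    simp [hzx, hxz]
  · refine le_trans (le_of_eq ?_) (liftedDist_le x z)
    have : Matrix.vecMulVec xhat (star xhat) = Matrix.vecMulVec x.ofLp (star x.ofLp) := by
      ext i j
      simp only [Matrix.vecMulVec_apply, Pi.star_apply, hx, WithLp.ofLp_smul, Pi.smul_apply,
        smul_eq_mul, star_mul']
      linear_combination -(xhat i * star (xhat j)) * hcc
    rw [liftedDist, liftedDist, this]
  · have hmin := isMinOn_iff.1 h x₀ (Set.mem_univ _)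
    simp only [empiricalRisk] at hmin
    rw [← sub_nonneg, ← Finset.sum_sub_distrib] at hmin
    rw [Finset.mul_sum, ← sub_nonneg, ← Finset.sum_sub_distrib]
    refine hmin.trans (le_of_eq (Finset.sum_congr rfl fun k _ => ?_))
    rw [hint k]
    ring

theorem sq_le_of_hasLowerBound {a : Fin n → Fin d → 𝕜} {l : ℝ} (hl : 0 < l)
    (ha : HasLowerBound a l) {p q : EuclideanSpace 𝕜 (Fin d)} (hpq : RCLike.im (inner 𝕜 p q) = 0) :
    (l * n * (‖p‖ * ‖q‖)) ^ 2 ≤ n * ∑ k, crossForm (a k) p q ^ 2 := by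
  have h1 := pow_le_pow_left₀ (by positivity) (ha p q hpq) 2
  have h2 := sq_sum_le_card_mul_sum_sq (s := Finset.univ) (f := fun k => |crossForm (a k) p q|)
  simp only [sq_abs, Finset.card_univ, Fintype.card_fin] at h2
  exact h1.trans h2

theorem IsERM.liftedDist_le_norm {a : Fin n → Fin d → 𝕜} {e : Fin n → ℝ} {x₀ xhat : Fin d → 𝕜}
    (h : IsERM a e x₀ xhat) (hn : 0 < n) {l : ℝ} (hl : 0 < l) (ha : HasLowerBound a l) :
    liftedDist xhat x₀ ≤ 2 / l * ‖WithLp.toLp 2 e‖ / √n := by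
  obtain ⟨p, q, hpq, hdist, hsum⟩ := IsERM.exists_pair h
  have hlow := sq_le_of_hasLowerBound hl ha hpq
  have hn' : (0 : ℝ) < n := by exact_mod_cast hn
  set S := ∑ k, crossForm (a k) p q ^ 2 with hS
  set P := ‖p‖ * ‖q‖ with hP
  have hP0 : 0 ≤ P := by positivity
  have hS0 : 0 ≤ S := Finset.sum_nonneg fun _ _ => sq_nonneg _
  have he : ‖WithLp.toLp 2 e‖ ^ 2 = ∑ k, e k ^ 2 := by
    rw [EuclideanSpace.norm_sq_eq]; simp
  have hcs := Finset.sum_mul_sq_le_sq_mul_sq Finset.univ e (fun k => crossForm (a k) p q)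
  rw [← he, ← hS] at hcs
  have hS4 : S ≤ 4 * ‖WithLp.toLp 2 e‖ ^ 2 := by
    rcases hS0.eq_or_lt with h0 | h0
    · rw [← h0]; positivity
    · have h1 : S ^ 2 ≤ (2 * ∑ k, e k * crossForm (a k) p q) ^ 2 := pow_le_pow_left₀ hS0 hsum 2
      have h2 : S * S ≤ 4 * ‖WithLp.toLp 2 e‖ ^ 2 * S := by nlinarith
      exact le_of_mul_le_mul_right h2 h0
  refine hdist.trans ?_
  have hsq : √(n : ℝ) ^ 2 = n := Real.sq_sqrt hn'.le
  have hsn : 0 < √(n : ℝ) := Real.sqrt_pos.2 hn'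
  have h3 : (l * n * P) ^ 2 ≤ (2 * ‖WithLp.toLp 2 e‖ * √n) ^ 2 := by
    rw [mul_pow _ (√(n : ℝ)), hsq]
    nlinarith
  have h4 := (abs_le_of_sq_le_sq' h3 (by positivity)).2
  have h5 : P ≤ (2 * ‖WithLp.toLp 2 e‖ * √n) / (l * n) := by
    rw [le_div_iff₀ (by positivity)]; linarith
  refine h5.trans (le_of_eq ?_)
  nth_rewrite 2 [← hsq]
  field_simp

theorem IsERM.liftedDist_le_of_weighted {a : Fin n → Fin d → 𝕜} {e : Fin n → ℝ}
    {x₀ xhat : Fin d → 𝕜} (h : IsERM a e x₀ xhat) (hn : 0 < n) {l : ℝ} (hl : 0 < l)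
    (ha : HasLowerBound a l) {T : ℝ} (hT0 : 0 ≤ T)
    (hT : ∀ p q, |∑ k, e k * crossForm (a k) p q| ≤ T * (‖p‖ * ‖q‖)) :
    liftedDist xhat x₀ ≤ 2 / l ^ 2 * T / n := by
  obtain ⟨p, q, hpq, hdist, hsum⟩ := IsERM.exists_pair h
  have hlow := sq_le_of_hasLowerBound hl ha hpq
  have hn' : (0 : ℝ) < n := by exact_mod_cast hn
  have hTpq := (le_abs_self _).trans (hT p q)
  set P := ‖p‖ * ‖q‖ with hP
  have hP0 : 0 ≤ P := by positivity
  refine hdist.trans ?_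
  rcases hP0.eq_or_lt with h0 | h0
  · rw [← h0]; positivity
  have h1 : (n * P) * (l ^ 2 * n * P) ≤ (n * P) * (2 * T) := by
    calc (n * P) * (l ^ 2 * n * P) = (l * n * P) ^ 2 := by ring
      _ ≤ n * ∑ k, crossForm (a k) p q ^ 2 := hlow
      _ ≤ n * (2 * (T * P)) := by gcongr; linarith
      _ = _ := by ring
  have h2 := le_of_mul_le_mul_left h1 (by positivity)
  have h3 : 2 / l ^ 2 * T / n = (2 * T) / (l ^ 2 * n) := by field_simp
  rw [h3, le_div_iff₀ (by positivity)]
  linarith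

theorem liftedDist_eq_zero (x z : Fin 0 → 𝕜) : liftedDist x z = 0 := by
  rw [Subsingleton.elim x z]; simp [liftedDist]

end Deterministic

/-- Transfer of a likely event from the law of `X`. As `X` is only almost everywhere measurable, the
preimage is replaced by a measurable subset of full measure. -/
theorem exists_measurableSet_of_map {Ω Y : Type*} [MeasurableSpace Ω] [MeasurableSpace Y]
    {P : Measure Ω} [IsProbabilityMeasure P] {X : Ω → Y} (hX : AEMeasurable X P) {G : Set Y}
    (hG : MeasurableSet G) {b : ℝ} (hb : (P.map X).real Gᶜ ≤ b) :
    ∃ E : Set Ω, MeasurableSet E ∧ 1 - b ≤ P.real E ∧ ∀ ω ∈ E, X ω ∈ G := by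
  obtain ⟨E, hsub, hE, hae⟩ := (hX.nullMeasurable hG).exists_measurable_subset_ae_eq
  have := Measure.isProbabilityMeasure_map hX
  refine ⟨E, hE, ?_, fun ω hω => hsub hω⟩
  have h1 : P.real E = (P.map X).real G := by
    rw [measureReal_congr hae, measureReal_def, measureReal_def,
      Measure.map_apply_of_aemeasurable hX hG]
  rw [probReal_compl_eq_one_sub hG] at hb
  linarith

theorem prod_measureReal_compl_le {Y Z : Type*} [MeasurableSpace Y] [MeasurableSpace Z]
    {ρ : Measure Y} [IsProbabilityMeasure ρ] {ν : Measure Z} [IsProbabilityMeasure ν]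
    {G : Set (Y × Z)} (hG : MeasurableSet G) {b : ℝ} (hb : 0 ≤ b)
    (h : ∀ y, ν.real {z | (y, z) ∉ G} ≤ b) : (ρ.prod ν).real Gᶜ ≤ b := by
  rw [measureReal_def, Measure.prod_apply hG.compl]
  refine ENNReal.toReal_le_of_le_ofReal hb ?_
  calc ∫⁻ y, ν (Prod.mk y ⁻¹' Gᶜ) ∂ρ ≤ ∫⁻ _y, ENNReal.ofReal b ∂ρ := by
        refine lintegral_mono fun y => ?_
        rw [← ENNReal.ofReal_toReal (measure_ne_top ν _)]
        exact ENNReal.ofReal_le_ofReal (h y)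
    _ = _ := by simp

end PhaseRetrieval

open PhaseRetrieval

/-- The constants depend only on the field, on an upper bound `K` for the sub-Gaussian norm of the
entry distribution `M`, and on a lower bound `κ` for `𝔼 M⁴ - (𝔼 M²)²`. In each part a single event
serves all signals `x₀` and all minimizers. In the bounds, `‖WithLp.toLp 2 (η ω)‖` is the Euclidean
norm and `‖η ω‖` the maximum norm of the noise vector. -/
theorem mainTheorem1 {𝕜 : Type*} [RCLike 𝕜] (K : ℝ≥0) (κ : ℝ) (hκ : 0 < κ) :
    ∃ C₁ C₂ C₃ C₄ C₅ : ℝ, 0 < C₁ ∧ 0 < C₂ ∧ 0 < C₃ ∧ 0 < C₄ ∧ 0 < C₅ ∧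
      ∀ (M : Measure ℝ) (_ : IsProbabilityMeasure M)
        (_ : ∫ t, t ∂M = 0)
        (_ : subGaussianNorm (fun t : ℝ => t) M ≤ K)
        (_ : (∫ t, t ^ 2 ∂M) ^ 2 + κ ≤ ∫ t, t ^ 4 ∂M)
        (n d : ℕ) (_ : C₁ * d ≤ n)
        (Ω : Type*) (_ : MeasurableSpace Ω) (P : Measure Ω) (_ : IsProbabilityMeasure P)
        (α : Fin n → Ω → Fin d → 𝕜)
        (_ : ∀ k, HasLaw (α k) (measurementLaw 𝕜 d M) P)
        (_ : iIndepFun α P)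
        (η : Ω → Fin n → ℝ) (_ : AEMeasurable η P)
        (_ : IndepFun η (fun ω k => α k ω) P),
        (∃ E : Set Ω, MeasurableSet E ∧ 1 - Real.exp (-C₂ * n) ≤ P.real E ∧
          ∀ ω ∈ E, ∀ x₀ xhat : Fin d → 𝕜, IsERM (fun k => α k ω) (η ω) x₀ xhat →
            liftedDist xhat x₀ ≤ C₃ * ‖WithLp.toLp 2 (η ω)‖ / √n) ∧
        (∃ E : Set Ω, MeasurableSet E ∧ 1 - Real.exp (-C₄ * d) ≤ P.real E ∧
          ∀ ω ∈ E, ∀ x₀ xhat : Fin d → 𝕜, IsERM (fun k => α k ω) (η ω) x₀ xhat →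
            liftedDist xhat x₀ ≤ C₅ * (‖η ω‖ * √(d / n) + |∑ k, η ω k| / n)) := by
  obtain ⟨c, m, hc, hm, hreg⟩ := exists_isRegularLaw 𝕜 K hκ
  set γ := m ^ 2 * c ^ 2 / 128 with hγ
  have hγ0 : 0 < γ := by positivity
  set δ := min 2 γ with hδ
  have hδ0 : 0 < δ := lt_min two_pos hγ0
  set L := 4 * Real.log (1 + 2 / (m * c / 144)) with hL
  have hL0 : 0 ≤ L := by
    have : 0 ≤ 2 / (m * c / 144) := by positivity
    have := Real.log_nonneg (show (1 : ℝ) ≤ 1 + 2 / (m * c / 144) by linarith)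
    positivity
  -- In `C₁`, the three terms give `d ≤ n`, absorb the cardinality of the net of pairs, and make
  -- `δ n` at least `3 d`, which also pays for the numerical prefactors of the union bounds.
  refine ⟨1 + L / γ + 3 / δ, δ / 2, 8 / m, 1, 32 / m ^ 2 * (164 / c), by positivity, by positivity,
    by positivity, one_pos, by positivity, ?_⟩
  intro M hM hmean hsub h4 n d hnd Ω hΩ P hP α hlaw hindep η hη hηα
  rcases Nat.eq_zero_or_pos d with rfl | hd
  · constructor <;> refine ⟨Set.univ, MeasurableSet.univ, ?_, fun ω _ x₀ xhat _ => ?_⟩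
    · rw [probReal_univ]; linarith [Real.exp_pos (-(δ / 2) * n)]
    · rw [liftedDist_eq_zero]; positivity
    · simp
    · rw [liftedDist_eq_zero]; positivity
  have hd' : (1 : ℝ) ≤ d := by exact_mod_cast hd
  have hdn : (d : ℝ) ≤ n := by
    have h1 : 0 ≤ L / γ * d := by positivity
    have h2 : 0 ≤ 3 / δ * d := by positivity
    linarith
  have hLn : L * d ≤ γ * n := by
    have h1 : L / γ * d ≤ n := by
      have h2 : 0 ≤ 3 / δ * d := by positivity
      linarith
    calc L * d = γ * (L / γ * d) := by field_simp
      _ ≤ γ * n := by gcongr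
  have hδn : 3 * (d : ℝ) ≤ δ * n := by
    have h1 : 3 / δ * d ≤ n := by
      have h2 : 0 ≤ L / γ * d := by positivity
      linarith
    calc 3 * (d : ℝ) = δ * (3 / δ * d) := by field_simp
      _ ≤ δ * n := by gcongr
  have hdn' : d ≤ n := by exact_mod_cast hdn
  have hn : 0 < n := hd.trans_le hdn'
  have hn' : (0 : ℝ) < n := by exact_mod_cast hn
  obtain ⟨s, hs⟩ := hreg M hM hmean hsub h4 d
  set ν := Measure.pi fun _ : Fin n => measurementLaw 𝕜 d M with hν
  have hα : AEMeasurable (fun ω k => α k ω) P := aemeasurable_pi_lambda _ fun k => (hlaw k).aemeasurable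
  have hmap : P.map (fun ω k => α k ω) = ν := by
    rw [(iIndepFun_iff_map_fun_eq_pi_map fun k => (hlaw k).aemeasurable).1 hindep]
    simp only [(hlaw _).map_eq, hν]
  obtain ⟨G, hG, hGprob, hGlow⟩ := exists_event_hasLowerBound (n := n) hc hm hs hdn' hLn
  have hGprob' : ν.real Gᶜ ≤ 2 * Real.exp (-δ * n) := by
    have h1 : Real.exp (-2 * n) ≤ Real.exp (-δ * n) := Real.exp_le_exp.2 (by
      have : δ ≤ 2 := min_le_left _ _
      nlinarith)
    have h2 : Real.exp (-γ * n) ≤ Real.exp (-δ * n) := Real.exp_le_exp.2 (by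
      have : δ ≤ γ := min_le_right _ _
      nlinarith)
    linarith
  have hl : 0 < m / 4 := by positivity
  constructor
  · have hfail : (P.map fun ω k => α k ω).real Gᶜ ≤ Real.exp (-(δ / 2) * n) := by
      rw [hmap]
      refine hGprob'.trans ?_
      have h1 : Real.exp (-(δ / 2) * n) = Real.exp (δ / 2 * n) * Real.exp (-δ * n) := by
        rw [← Real.exp_add]; ring_nf
      rw [h1]
      gcongr
      linarith [Real.add_one_le_exp (δ / 2 * n)]
    obtain ⟨E, hE, hprob, hEG⟩ := exists_measurableSet_of_map hα hG hfail
    refine ⟨E, hE, hprob, fun ω hω x₀ xhat herm => ?_⟩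
    refine (IsERM.liftedDist_le_norm herm hn hl (hGlow _ (hEG ω hω))).trans (le_of_eq ?_)
    congr 2
    field_simp; norm_num
  · obtain ⟨G', hG', hG'prob, hG'bound⟩ := exists_event_abs_weighted_sum_le (n := n) hc hs hd hdn'
    have hηα' : AEMeasurable (fun ω => (η ω, fun k => α k ω)) P := hη.prodMk hα
    have hηprob := Measure.isProbabilityMeasure_map hη
    have hGG : MeasurableSet (G' ∩ Prod.snd ⁻¹' G) := hG'.inter (measurable_snd hG)
    have hfail : (P.map fun ω => (η ω, fun k => α k ω)).real (G' ∩ Prod.snd ⁻¹' G)ᶜ ≤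
        Real.exp (-1 * d) := by
      rw [(indepFun_iff_map_prod_eq_prod_map_map hη hα).1 hηα, hmap]
      refine prod_measureReal_compl_le hGG (Real.exp_pos _).le fun e => ?_
      have hsubset : {a : Fin n → Fin d → 𝕜 | (e, a) ∉ G' ∩ Prod.snd ⁻¹' G} ⊆
          {a | (e, a) ∉ G'} ∪ Gᶜ := by
        intro a ha
        by_contra hcon
        simp only [Set.mem_union, not_or, Set.mem_compl_iff, not_not] at hcon
        exact ha ⟨not_not.1 hcon.1, hcon.2⟩
      have h1 : Real.exp (-δ * n) ≤ Real.exp (-3 * d) := Real.exp_le_exp.2 (by linarith)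
      have h2 : Real.exp (-1 * (d : ℝ)) = Real.exp (2 * d) * Real.exp (-3 * d) := by
        rw [← Real.exp_add]; ring_nf
      have h3 : (4 : ℝ) ≤ Real.exp (2 * d) := by
        have := Real.quadratic_le_exp_of_nonneg (x := 2 * (d : ℝ)) (by positivity)
        nlinarith
      calc ν.real {a | (e, a) ∉ G' ∩ Prod.snd ⁻¹' G}
          ≤ ν.real ({a | (e, a) ∉ G'} ∪ Gᶜ) := measureReal_mono hsubset (measure_ne_top _ _)
        _ ≤ 2 * Real.exp (-3 * d) + 2 * Real.exp (-3 * d) :=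
          (measureReal_union_le _ _).trans
            (add_le_add (hG'prob e) (hGprob'.trans (by linarith)))
        _ = 4 * Real.exp (-3 * d) := by ring
        _ ≤ Real.exp (-1 * d) := by rw [h2]; gcongr
    obtain ⟨E, hE, hprob, hEG⟩ := exists_measurableSet_of_map hηα' hGG hfail
    refine ⟨E, hE, hprob, fun ω hω x₀ xhat herm => ?_⟩
    obtain ⟨hω1, hω2⟩ := hEG ω hω
    refine (IsERM.liftedDist_le_of_weighted herm hn hl (hGlow _ hω2) (by positivity)
      (hG'bound _ _ hω1)).trans (le_of_eq ?_)
    have h5 : √((d : ℝ) / n) = √(d * n) / n := by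
      have : (d : ℝ) / n = d * n / n ^ 2 := by field_simp
      rw [this, Real.sqrt_div' _ (by positivity), Real.sqrt_sq hn'.le]
    rw [h5]
    field_simp
    ring
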